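/- **Setting.** Threads of a client program run over a client component and a library component of an RC11-RAR style timestamp memory. The state of a component consists of a set $\mathtt{ops}$ of timestamped modifying operations $(a,q)$, $q\in\mathbb Q$, a view $\mathtt{tview}_t$ for each thread $t$ (a map from locations to operations), a view $\mathtt{mview}_w$ of both components for each operation $w$, and a set $\mathtt{cvd}$ of covered operations. Write $\mathrm{tst}(a,q)=q$ and $\mathtt{Obs}(t,x)=\{w\in\mathtt{ops}: \mathrm{var}(w)=x,\ \mathrm{tst}(\mathtt{tview}_t(x))\le \mathrm{tst}(w)\}$. A read takes its value from a $w\in\mathtt{Obs}(t,x)$; an acquiring read of a releasing $w$ joins $\mathtt{mview}_w$ into the views of $t$ in both components. A write or update is placed at a fresh timestamp immediately after some uncovered $w\in\mathtt{Obs}(t,x)$ and records the resulting views of $t$ as its $\mathtt{mview}$; an update covers the $w$ that it reads, and synchronises with it if the update is acquiring and $w$ is releasing. **Abstract stack.** The library operations are timestamped pushes and pops, with a relation $\mathtt{matched}$ between timestamps of pushes and of the pops that remove them. A new operation of thread $t$ gets a timestamp $ts'$ later than $t$'s view of the stack and outside every interval $[tt,tt']$ with $(tt,tt')\in\mathtt{matched}$.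 A nonempty pop at $ts'$ is matched with an unmatched push at some $ts<ts'$ of the value it returns, where all pushes with timestamp strictly between $ts$ and $ts'$ are matched. A pop may return $empty$ at a $ts'$ later than $t$'s view if every earlier operation is matched or is a pop returning $empty$. A releasing push records the stack view and the client view of its thread as its $\mathtt{mview}$; an acquiring pop of a releasing push joins that $\mathtt{mview}$ into the views of its thread. Initially the stack holds only a pop returning $empty$, at timestamp $0$. The call $push^{\sf R}(u)$ takes effect and returns $\bot$ in one step; the call $pop^{\sf A}()$ takes effect in one step, and a second, silent step returns the value. The variable $rval$ of each thread holds the value returned by its last call. **Treiber stack.** The library locations are $Top$ (initially $null=0$) and cells (initially $0$). - $push^{\sf R}(v)$: choose $a\neq null$ with $a,a+1\notin usedAddr$, add both to $usedAddr$, and set $nVal_t:=a$, $nNxt_t:=a+1$; write $v$ to cell $nVal_t$ (relaxed); then repeat: read $Top$ into $top_t$ (acquiring), write $top_t$ to cell $nNxt_t$ (relaxed); until $\mathrm{CAS}^{\sf R}(Top,top_t,nVal_t)$ succeeds, which adds $nVal_t$ to the auxiliary set $pushedAddr$ and returns $\bot$. - $pop^{\sf A}()$: repeat: read $Top$ into $top_t$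 (acquiring) until $top_t\ne null$, read cell $top_t+1$ into $nTop_t$ (relaxed); until $\mathrm{CAS}^{\sf R}(Top,top_t,nTop_t)$ succeeds, which removes $top_t$ from $pushedAddr$; then read cell $top_t$ (relaxed) into $rval_t$ and return it. A failed CAS is a relaxed read of a value different from the expected one. **The relation $R_{TS}$.** For an abstract state with client state $\gamma_A$ and stack state $\alpha$, and a concrete state with client state $\gamma_C$ and library state $\beta$, let $\mathit{lastVal}_\beta(x)$ be the value of the last write to $x$ in $\beta$, and let $U_\alpha$ be the set of unmatched pushes of $\alpha$. $R_{TS}$ holds iff the client registers, the values of $rval$, and the sets $\mathtt{ops}$ and $\mathtt{cvd}$ of the client agree on both sides, and there is a map $f$ from addresses to stack operations, injective on $pushedAddr\cup\{null\}$, with $f(null)=(pop(empty),ts)$ for some $ts$, such that 1. for $a\in pushedAddr$: $f(a)\in U_\alpha$, $f(a)$ pushes the value $\mathit{lastVal}_\beta(a)$, and $\mathrm{tst}(f(a))>\mathrm{tst}(f(\mathit{lastVal}_\beta(a+1)))$; 2. for $a\in pushedAddr$ and $op\in U_\alpha$ with $op\ne f(a)$ and $op\neq f(\mathit{lastVal}_\beta(a+1))$: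 $\mathrm{tst}(op)<\mathrm{tst}(f(\mathit{lastVal}_\beta(a+1)))$ or $\mathrm{tst}(op)>\mathrm{tst}(f(a))$; 3. if $\mathit{lastVal}_\beta(Top)\ne null$, then $f(\mathit{lastVal}_\beta(Top))$ is the element of $U_\alpha$ with the largest timestamp; 4. for every thread $t$, $a\in pushedAddr$ with $top_t=a$, and client variable $x$: $\mathrm{tst}(\alpha.\mathtt{mview}_{f(a)}(x))\le \mathrm{tst}(\gamma_C.\mathtt{tview}_t(x))$; 5. for $a\in pushedAddr$, every $w\in\beta.\mathtt{ops}$ that writes $a$ to $Top$, and every client variable $x$: $\mathrm{tst}(\alpha.\mathtt{mview}_{f(a)}(x))\le\mathrm{tst}(\beta.\mathtt{mview}_w(x))$; 6. for all $t$ and client variables $x$: $\mathrm{tst}(\gamma_A.\mathtt{tview}_t(x))\le\mathrm{tst}(\gamma_C.\mathtt{tview}_t(x))$. **Proposition.** Let $C$ be any concurrent client program with calls to $push^{\sf R}$ and $pop^{\sf A}$ that is synchronisation-free (none of its own accesses is acquiring), with any initialisation of its variables and registers. Then $R_{TS}$ is a forward simulation between $C$ using the abstract stack and $C$ using the Treiber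 stack, that is: - *(client observation)* if $R_{TS}$ holds, then both sides have the same client registers, and for every thread $t$ they have the same $rval_t$ and $\gamma_C.\mathtt{Obs}(t,x)\subseteq\gamma_A.\mathtt{Obs}(t,x)$ for every client variable $x$; - *(initialisation)* the initial configurations are at corresponding program points and their states are related by $R_{TS}$; - *(step)* let $\Omega$ and $\Psi$ be reachable abstract and concrete configurations at corresponding program points whose states are related by $R_{TS}$, and let $\Psi\Longrightarrow\Psi'$ be a step of the Treiber stack. Then either $\Omega$ and $\Psi'$ are again at corresponding program points with states related by $R_{TS}$, or there is an abstract step $\Omega\Longrightarrow\Omega'$ such that $\Omega'$ and $\Psi'$ are. Here two configurations are at corresponding program points if their programs agree except that a Treiber call in progress corresponds, up to its successful CAS, to the same abstract call not yet executed, and a Treiber pop of thread $t$ between its successful CAS and its return corresponds to an abstract pop that has taken effect and is about to return $\mathit{lastVal}_\beta(top_t)$. -/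

import Mathlib

noncomputable section

namespace TreiberC11

/-! ## Values, actions, component states -/

/-- Values held by client variables and registers: numbers, and the value `empty` that a pop of
the abstract stack returns on an empty stack. -/
inductive Val where
  | num (n : ℕ)
  | empty

/-- Memory actions on locations `L` with values `V`: reads (possibly acquiring), writes (possibly
releasing) and updates (possibly releasing, possibly acquiring). -/
inductive Act (L V : Type*) where
  | rd (acq : Bool) (x : L) (v : V)
  | wr (rel : Bool) (x : L) (v : V)
  | upd (rel acq : Bool) (x : L) (u v : V)

namespace Act
variable {L V : Type*}

/-- The location accessed. -/
def loc : Act L V → L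
  | rd _ x _ => x
  | wr _ x _ => x
  | upd _ _ x _ _ => x

/-- The value written, if any. -/
def wrval : Act L V → Option V
  | rd _ _ _ => none
  | wr _ _ v => some v
  | upd _ _ _ _ v => some v

/-- Releasing writes and updates. -/
def IsRel : Act L V → Prop
  | rd _ _ _ => False
  | wr rel _ _ => rel = true
  | upd rel _ _ _ _ => rel = true

end Act

/-- Function update. -/
def fupd {α β : Type*} (f : α → β) (a : α) (b : β) : α → β :=
  open Classical in fun x => if x = a then b else f x

/-- The timestamp of an operation. -/
abbrev tst {A : Type*} (w : A × ℚ) : ℚ := w.2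

/-- A view maps each location to a timestamped operation. -/
abbrev View (L A : Type*) := L → A × ℚ

/-- `V₁ ⊗ V₂`: for each location, the later of the two entries. -/
def View.join {L A : Type*} (V₁ V₂ : View L A) : View L A :=
  fun x => if tst (V₂ x) ≤ tst (V₁ x) then V₁ x else V₂ x

/-- The weak memory state of one component (client or library) whose locations are `L` and whose
modifying operations are `A`; the other component (the context) has locations `L'` and
operations `A'`. The modification view of an operation ranges over both components:
`mview` is its part in this component and `mviewCtx` its part in the context. -/
structure CompState (T L A L' A' : Type*) where
  ops : Set (A × ℚ)
  tview : T → View L A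
  mview : A × ℚ → View L A
  mviewCtx : A × ℚ → View L' A'
  cvd : Set (A × ℚ)

namespace CompState
variable {T L A L' A' V : Type*}

/-- Replace the view of thread `t`. -/
def setView (σ : CompState T L A L' A') (t : T) (v : View L A) : CompState T L A L' A' :=
  { σ with tview := fupd σ.tview t v }

/-- The writes to `x` that thread `t` can observe. -/
def Obs (σ : CompState T L (Act L V) L' A') (t : T) (x : L) : Set (Act L V × ℚ) :=
  {w | w ∈ σ.ops ∧ w.1.loc = x ∧ tst (σ.tview t x) ≤ tst w}

/-- `q'` is a fresh timestamp immediately after `q`. -/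
def Fresh (σ : CompState T L A L' A') (q q' : ℚ) : Prop :=
  q < q' ∧ ∀ w ∈ σ.ops, q < tst w → q' < tst w

/-- `w` is a last write to `x`. -/
def IsLast (σ : CompState T L (Act L V) L' A') (x : L) (w : Act L V × ℚ) : Prop :=
  w ∈ σ.ops ∧ w.1.loc = x ∧ ∀ w' ∈ σ.ops, w'.1.loc = x → tst w' ≤ tst w

/-- The value of the last write to `x`. -/
def lastVal [Nonempty V] (σ : CompState T L (Act L V) L' A') (x : L) : V :=
  Classical.epsilon fun v => ∃ w, σ.IsLast x w ∧ w.1.wrval = some v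

/-- The initial state of a component whose location `x` is initialised with `k x`, where
`vctx` is the initial view of the context. -/
def init (k : L → V) (vctx : View L' A') : CompState T L (Act L V) L' A' where
  ops := {w | ∃ x, w = (Act.wr false x (k x), 0)}
  tview := fun _ x => (Act.wr false x (k x), 0)
  mview := fun _ x => (Act.wr false x (k x), 0)
  mviewCtx := fun _ => vctx
  cvd := ∅

end CompState

/-! ## Memory semantics -/

section Memory
open Classical
variable {T L V L' A' : Type*}

/-- `MemStep t a γ v γ' v'`: thread `t` performs the action `a` in the component with state `γ`,
which becomes `γ'`; its view of the context changes from `v` to `v'`. -/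
inductive MemStep (t : T) : Act L V →
    CompState T L (Act L V) L' A' → View L' A' →
    CompState T L (Act L V) L' A' → View L' A' → Prop
  | read (γ : CompState T L (Act L V) L' A') (v : View L' A') (acq : Bool) (x : L) (n : V)
      (w : Act L V × ℚ) :
      w ∈ γ.Obs t x → w.1.wrval = some n →
      MemStep t (.rd acq x n) γ v
        (γ.setView t (if w.1.IsRel ∧ acq = true then View.join (γ.tview t) (γ.mview w)
          else fupd (γ.tview t) x w))
        (if w.1.IsRel ∧ acq = true then View.join v (γ.mviewCtx w) else v)
  | write (γ : CompState T L (Act L V) L' A') (v : View L' A') (rel : Bool) (x : L) (n : V)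
      (w : Act L V × ℚ) (q' : ℚ) (e : Act L V × ℚ) (tv : View L (Act L V)) :
      w ∈ γ.Obs t x → w ∉ γ.cvd → γ.Fresh (tst w) q' →
      e = (.wr rel x n, q') →
      tv = fupd (γ.tview t) x e →
      MemStep t (.wr rel x n) γ v
        { ops := γ.ops ∪ {e}
          tview := fupd γ.tview t tv
          mview := fupd γ.mview e tv
          mviewCtx := fupd γ.mviewCtx e v
          cvd := γ.cvd } v
  | updateRA (γ : CompState T L (Act L V) L' A') (v : View L' A') (x : L) (m n : V)
      (w : Act L V × ℚ) (q' : ℚ) (e : Act L V × ℚ) (tv : View L (Act L V)) (v' : View L' A') :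
      w ∈ γ.Obs t x → w ∉ γ.cvd → w.1.wrval = some m → γ.Fresh (tst w) q' →
      e = (.upd true true x m n, q') →
      tv = (if w.1.IsRel then View.join (fupd (γ.tview t) x e) (γ.mview w)
        else fupd (γ.tview t) x e) →
      v' = (if w.1.IsRel then View.join v (γ.mviewCtx w) else v) →
      MemStep t (.upd true true x m n) γ v
        { ops := γ.ops ∪ {e}
          tview := fupd γ.tview t tv
          mview := fupd γ.mview e tv
          mviewCtx := fupd γ.mviewCtx e v'
          cvd := γ.cvd ∪ {w} } v'
  | updateRel (γ : CompState T L (Act L V) L' A') (v : View L' A') (x : L) (m n : V)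
      (w : Act L V × ℚ) (q' : ℚ) (e : Act L V × ℚ) (tv : View L (Act L V)) :
      w ∈ γ.Obs t x → w ∉ γ.cvd → w.1.wrval = some m → γ.Fresh (tst w) q' →
      e = (.upd true false x m n, q') →
      tv = fupd (γ.tview t) x e →
      MemStep t (.upd true false x m n) γ v
        { ops := γ.ops ∪ {e}
          tview := fupd γ.tview t tv
          mview := fupd γ.mview e tv
          mviewCtx := fupd γ.mviewCtx e v
          cvd := γ.cvd ∪ {w} } v

end Memory

/-! ## The abstract stack -/

/-- Abstract stack operations: a push (possibly releasing) of a number, and a pop (possibly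
acquiring) that returns a number or `empty`. -/
inductive StackAct where
  | push (rel : Bool) (u : ℕ)
  | pop (acq : Bool) (u : Val)

def StackAct.IsPush : StackAct → Prop
  | push _ _ => True
  | pop _ _ => False

/-- The state of the abstract stack; the stack is a single object, so views of it are indexed by
`Unit`. `(ts, ts') ∈ matched` means that the push with timestamp `ts` is popped by the pop with
timestamp `ts'`. The client has locations `X`. -/
structure StackState (T X : Type*) extends CompState T Unit StackAct X (Act X Val) where
  matched : Set (ℚ × ℚ)

section Stack
variable {T X : Type*}

/-- The unmatched pushes. -/
def StackState.unmatchedPush (α : StackState T X) : Set (StackAct × ℚ) :=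
  {op | op ∈ α.ops ∧ op.1.IsPush ∧ ∀ ts', (op.2, ts') ∉ α.matched}

/-- Common part of pushes and pops: the new operation `e` is introduced after the view of `t` and
outside all intervals between matched operations. -/
def StackBase (t : T) (e : StackAct × ℚ) (α α' : StackState T X) : Prop :=
  tst (α.tview t ()) < tst e ∧
  (∀ p ∈ α.matched, tst e < p.1 ∨ p.2 < tst e) ∧
  α' = { α with ops := α.ops ∪ {e}, tview := fupd α.tview t (fun _ => e) }

/-- Common part of nonempty pops: the pop `e` is matched with the operation `w`. -/
def PopBase (t : T) (e w : StackAct × ℚ) (α α' : StackState T X) : Prop :=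
  ∃ α₁, StackBase t e α α₁ ∧ w ∈ α.ops ∧ (∀ ts', (tst w, ts') ∉ α.matched) ∧ tst w < tst e ∧
    (∀ o ∈ α.ops, o.1.IsPush → tst w < tst o → tst o < tst e → ∃ ts', (tst o, ts') ∈ α.matched) ∧
    α' = { α₁ with matched := α₁.matched ∪ {(tst w, tst e)} }

/-- `StackStep t a α v α' v'`: thread `t` performs the stack operation `a`; its view of the client
changes from `v` to `v'`. -/
inductive StackStep (t : T) : StackAct →
    StackState T X → View X (Act X Val) → StackState T X → View X (Act X Val) → Prop
  | pushRlx (u : ℕ) (ts' : ℚ) (α α' : StackState T X) (v : View X (Act X Val)) :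
      StackBase t (.push false u, ts') α α' →
      StackStep t (.push false u) α v α' v
  | pushSync (u : ℕ) (ts' : ℚ) (α α' : StackState T X) (v : View X (Act X Val)) :
      StackBase t (.push true u, ts') α α' →
      StackStep t (.push true u) α v
        { α' with
          mview := fupd α'.mview (.push true u, ts') (α'.tview t)
          mviewCtx := fupd α'.mviewCtx (.push true u, ts') v } v
  | popRlx (acq rel : Bool) (u : ℕ) (ts ts' : ℚ) (α α' : StackState T X)
      (v : View X (Act X Val)) :
      PopBase t (.pop acq (.num u), ts') (.push rel u, ts) α α' →
      ¬ (rel = true ∧ acq = true) →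
      StackStep t (.pop acq (.num u)) α v α' v
  | popSync (u : ℕ) (ts ts' : ℚ) (α α' : StackState T X) (v : View X (Act X Val)) :
      PopBase t (.pop true (.num u), ts') (.push true u, ts) α α' →
      StackStep t (.pop true (.num u)) α v
        { α' with
          tview := fupd α'.tview t (View.join (α'.tview t) (α.mview (.push true u, ts))) }
        (View.join v (α.mviewCtx (.push true u, ts)))
  | popEmpty (acq : Bool) (ts' : ℚ) (α : StackState T X) (v : View X (Act X Val)) :
      tst (α.tview t ()) < ts' →
      (∀ o ∈ α.ops, tst o < ts' →
        (∃ p ∈ α.matched, tst o = p.1 ∨ tst o = p.2) ∨ ∃ b, o.1 = .pop b .empty) →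
      StackStep t (.pop acq .empty) α v
        { α with
          ops := α.ops ∪ {(.pop acq .empty, ts')}
          tview := fupd α.tview t (fun _ => (.pop acq .empty, ts')) } v

/-- The initial stack: a pop returning `empty` with timestamp `0`. -/
def StackState.init (vctx : View X (Act X Val)) : StackState T X where
  ops := {(.pop false .empty, 0)}
  tview := fun _ _ => (.pop false .empty, 0)
  mview := fun _ _ => (.pop false .empty, 0)
  mviewCtx := fun _ => vctx
  cvd := ∅
  matched := ∅

end Stack

/-! ## Client programs with holes -/

/-- The valuation of the client registers of a thread. -/
abbrev Regs (R : Type*) := R → Val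

/-- The contents of a hole: a method call `d` in progress, or the result of a completed call,
where `none` stands for the null value `⊥`. -/
inductive Hole (D : Type*) where
  | run (d : D)
  | val (v : Option Val)

/-- Sequential programs over registers `R` and global client variables `X` with holes. -/
inductive Com (R X D : Type*) where
  | skip
  | assign (r : R) (e : Regs R → Val)
  | write (rel : Bool) (x : X) (e : Regs R → Val)
  | read (acq : Bool) (r : R) (x : X)
  | cas (rel acq : Bool) (r : R) (x : X) (u v : Regs R → Val)
  | fai (rel acq : Bool) (r : R) (x : X)
  | call (h : Hole D)
  | callTo (r : R) (h : Hole D)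
  | seq (c₁ c₂ : Com R X D)
  | ite (b : Regs R → Bool) (c₁ c₂ : Com R X D)
  | while (b : Regs R → Bool) (c : Com R X D)

section Programs
variable {R X D D' : Type*}

def Hole.map (f : D → D') : Hole D → Hole D'
  | run d => run (f d)
  | val v => val v

/-- Fill the holes. -/
def Com.map (f : D → D') : Com R X D → Com R X D'
  | skip => skip
  | assign r e => assign r e
  | write rel x e => write rel x e
  | read acq r x => read acq r x
  | cas rel acq r x u v => cas rel acq r x u v
  | fai rel acq r x => fai rel acq r x
  | call h => call (h.map f)
  | callTo r h => callTo r (h.map f)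
  | seq c₁ c₂ => seq (c₁.map f) (c₂.map f)
  | ite b c₁ c₂ => ite b (c₁.map f) (c₂.map f)
  | .while b c => .while b (c.map f)

/-- The client performs no acquiring access of its own. As threads synchronise only through an
acquiring access, it then synchronises only through the methods it calls. -/
def Com.SyncFree : Com R X D → Prop
  | read acq _ _ => acq = false
  | cas _ acq _ _ _ _ => acq = false
  | fai _ acq _ _ => acq = false
  | seq c₁ c₂ => c₁.SyncFree ∧ c₂.SyncFree
  | ite _ c₁ c₂ => c₁.SyncFree ∧ c₂.SyncFree
  | .while _ c => c.SyncFree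
  | _ => True

/-- Client steps of a sequential program, labelled by a memory action or by `none` (silent). -/
inductive CliStep : Com R X D → Regs R → Option (Act X Val) → Com R X D → Regs R → Prop
  | assign (r : R) (e : Regs R → Val) (ρ : Regs R) :
      CliStep (.assign r e) ρ none .skip (fupd ρ r (e ρ))
  | write (rel : Bool) (x : X) (e : Regs R → Val) (ρ : Regs R) :
      CliStep (.write rel x e) ρ (some (.wr rel x (e ρ))) .skip ρ
  | read (acq : Bool) (r : R) (x : X) (v : Val) (ρ : Regs R) :
      CliStep (.read acq r x) ρ (some (.rd acq x v)) .skip (fupd ρ r v)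
  | casFail (rel acq : Bool) (r : R) (x : X) (u v : Regs R → Val) (v' : Val) (ρ : Regs R) :
      v' ≠ u ρ →
      CliStep (.cas rel acq r x u v) ρ (some (.rd false x v')) .skip (fupd ρ r (.num 0))
  | casSucc (rel acq : Bool) (r : R) (x : X) (u v : Regs R → Val) (ρ : Regs R) :
      CliStep (.cas rel acq r x u v) ρ (some (.upd rel acq x (u ρ) (v ρ))) .skip
        (fupd ρ r (.num 1))
  | fai (rel acq : Bool) (r : R) (x : X) (n : ℕ) (ρ : Regs R) :
      CliStep (.fai rel acq r x) ρ (some (.upd rel acq x (.num n) (.num (n + 1)))) .skip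
        (fupd ρ r (.num n))
  | callVal (v : Option Val) (ρ : Regs R) : CliStep (.call (.val v)) ρ none .skip ρ
  | callToVal (r : R) (v : Val) (ρ : Regs R) :
      CliStep (.callTo r (.val (some v))) ρ none .skip (fupd ρ r v)
  | callToBot (r : R) (ρ : Regs R) : CliStep (.callTo r (.val none)) ρ none .skip ρ
  | seq (c₁ c₁' c₂ : Com R X D) (ρ ρ' : Regs R) (a : Option (Act X Val)) :
      CliStep c₁ ρ a c₁' ρ' → CliStep (.seq c₁ c₂) ρ a (.seq c₁' c₂) ρ'
  | seqSkip (c₂ : Com R X D) (ρ : Regs R) : CliStep (.seq .skip c₂) ρ none c₂ ρ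
  | iteTrue (b : Regs R → Bool) (c₁ c₂ : Com R X D) (ρ : Regs R) :
      b ρ = true → CliStep (.ite b c₁ c₂) ρ none c₁ ρ
  | iteFalse (b : Regs R → Bool) (c₁ c₂ : Com R X D) (ρ : Regs R) :
      b ρ = false → CliStep (.ite b c₁ c₂) ρ none c₂ ρ
  | whileTrue (b : Regs R → Bool) (c : Com R X D) (ρ : Regs R) :
      b ρ = true → CliStep (.while b c) ρ none (.seq c (.while b c)) ρ
  | whileFalse (b : Regs R → Bool) (c : Com R X D) (ρ : Regs R) :
      b ρ = false → CliStep (.while b c) ρ none .skip ρ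

/-- `HoleStep c d h c'`: the method call `d` is running in the active hole of `c`, and `c'` is `c`
with the contents of that hole replaced by `h`. -/
inductive HoleStep (d : D) (h : Hole D) : Com R X D → Com R X D → Prop
  | call : HoleStep d h (.call (.run d)) (.call h)
  | callTo (r : R) : HoleStep d h (.callTo r (.run d)) (.callTo r h)
  | seq (c₁ c₁' c₂ : Com R X D) : HoleStep d h c₁ c₁' → HoleStep d h (.seq c₁ c₂) (.seq c₁' c₂)

/-- Two programs differ only in the contents of their holes, which are related by `rel`. -/
inductive ComCorr (rel : D → D' → Prop) : Com R X D → Com R X D' → Prop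
  | skip : ComCorr rel .skip .skip
  | assign (r : R) (e : Regs R → Val) : ComCorr rel (.assign r e) (.assign r e)
  | write (b : Bool) (x : X) (e : Regs R → Val) : ComCorr rel (.write b x e) (.write b x e)
  | read (b : Bool) (r : R) (x : X) : ComCorr rel (.read b r x) (.read b r x)
  | cas (b b' : Bool) (r : R) (x : X) (u v : Regs R → Val) :
      ComCorr rel (.cas b b' r x u v) (.cas b b' r x u v)
  | fai (b b' : Bool) (r : R) (x : X) : ComCorr rel (.fai b b' r x) (.fai b b' r x)
  | callRun (d : D) (d' : D') : rel d d' → ComCorr rel (.call (.run d)) (.call (.run d'))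
  | callVal (v : Option Val) : ComCorr rel (.call (.val v)) (.call (.val v))
  | callToRun (r : R) (d : D) (d' : D') :
      rel d d' → ComCorr rel (.callTo r (.run d)) (.callTo r (.run d'))
  | callToVal (r : R) (v : Option Val) :
      ComCorr rel (.callTo r (.val v)) (.callTo r (.val v))
  | seq (c₁ c₂ : Com R X D) (c₁' c₂' : Com R X D') :
      ComCorr rel c₁ c₁' → ComCorr rel c₂ c₂' → ComCorr rel (.seq c₁ c₂) (.seq c₁' c₂')
  | ite (b : Regs R → Bool) (c₁ c₂ : Com R X D) (c₁' c₂' : Com R X D') :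
      ComCorr rel c₁ c₁' → ComCorr rel c₂ c₂' → ComCorr rel (.ite b c₁ c₂) (.ite b c₁' c₂')
  | while (b : Regs R → Bool) (c : Com R X D) (c' : Com R X D') :
      ComCorr rel c c' → ComCorr rel (.while b c) (.while b c')

end Programs

/-- The synchronising methods of the stack: `push^R(e)` and `pop^A()`. -/
inductive Meth (R : Type*) where
  | push (e : Regs R → ℕ)
  | pop

/-- A concurrent client program: one sequential program with method calls per thread. -/
abbrev Client (T R X : Type*) := T → Com R X (Meth R)

/-! ## The client using the abstract stack -/

/-- An abstract method call in progress: not yet executed, or a pop that has taken effect with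
result `u` and has yet to return. -/
inductive ARun (R : Type*) where
  | start (m : Meth R)
  | popRet (u : Val)

/-- Program steps of an abstract call; the last argument is the new value of the special
variable `rval`, the third its old value. -/
inductive ARunStep {R : Type*} (ρ : Regs R) :
    ARun R → Option Val → Option StackAct → Hole (ARun R) → Option Val → Prop
  | push (e : Regs R → ℕ) (rv : Option Val) :
      ARunStep ρ (.start (.push e)) rv (some (.push true (e ρ))) (.val none) none
  | pop (u : Val) (rv : Option Val) :
      ARunStep ρ (.start .pop) rv (some (.pop true u)) (.run (.popRet u)) rv
  | ret (u : Val) (rv : Option Val) :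
      ARunStep ρ (.popRet u) rv none (.val (some u)) (some u)

structure AState (T R X : Type*) where
  regs : T → Regs R
  rval : T → Option Val
  cl : CompState T X (Act X Val) Unit StackAct
  lib : StackState T X

structure AConf (T R X : Type*) where
  prog : T → Com R X (ARun R)
  st : AState T R X

section Abstract
variable {T R X : Type*}

/-- Steps of the client using the abstract stack. -/
inductive AStep : AConf T R X → AConf T R X → Prop
  | cliEps (Ω : AConf T R X) (t : T) (c' : Com R X (ARun R)) (ρ' : Regs R) :
      CliStep (Ω.prog t) (Ω.st.regs t) none c' ρ' →
      AStep Ω ⟨fupd Ω.prog t c', { Ω.st with regs := fupd Ω.st.regs t ρ' }⟩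
  | cliAct (Ω : AConf T R X) (t : T) (c' : Com R X (ARun R)) (ρ' : Regs R) (a : Act X Val)
      (γ' : CompState T X (Act X Val) Unit StackAct) (v' : View Unit StackAct) :
      CliStep (Ω.prog t) (Ω.st.regs t) (some a) c' ρ' →
      MemStep t a Ω.st.cl (Ω.st.lib.tview t) γ' v' →
      AStep Ω ⟨fupd Ω.prog t c', { Ω.st with
        regs := fupd Ω.st.regs t ρ'
        cl := γ'
        lib := { Ω.st.lib with tview := fupd Ω.st.lib.tview t v' } }⟩
  | libEps (Ω : AConf T R X) (t : T) (d : ARun R) (h : Hole (ARun R)) (c' : Com R X (ARun R))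
      (rv' : Option Val) :
      HoleStep d h (Ω.prog t) c' →
      ARunStep (Ω.st.regs t) d (Ω.st.rval t) none h rv' →
      AStep Ω ⟨fupd Ω.prog t c', { Ω.st with rval := fupd Ω.st.rval t rv' }⟩
  | libAct (Ω : AConf T R X) (t : T) (d : ARun R) (h : Hole (ARun R)) (c' : Com R X (ARun R))
      (rv' : Option Val) (a : StackAct) (α' : StackState T X) (v' : View X (Act X Val)) :
      HoleStep d h (Ω.prog t) c' →
      ARunStep (Ω.st.regs t) d (Ω.st.rval t) (some a) h rv' →
      StackStep t a Ω.st.lib (Ω.st.cl.tview t) α' v' →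
      AStep Ω ⟨fupd Ω.prog t c', { Ω.st with
        rval := fupd Ω.st.rval t rv'
        cl := Ω.st.cl.setView t v'
        lib := α' }⟩

/-- The initial configuration of a client using the abstract stack: client variables are
initialised by `k`, registers by `l`. -/
def AConf.init (C : Client T R X) (k : X → Val) (l : T → Regs R) : AConf T R X where
  prog := fun t => (C t).map ARun.start
  st :=
    { regs := l
      rval := fun _ => none
      cl := CompState.init k (fun _ => (.pop false .empty, 0))
      lib := StackState.init (fun x => (.wr false x (k x), 0)) }

end Abstract

/-! ## The client using the Treiber stack -/

/-- Library locations: the pointer `Top` and memory cells. Cells hold numbers, which serve as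
values and as addresses; `0` is the null pointer. -/
inductive LLoc where
  | Top
  | cell (a : ℕ)

/-- The null pointer. -/
abbrev null : ℕ := 0

/-- Method calls of the Treiber stack in progress, by the line to be executed next. A node
occupies two consecutive cells `a` (value) and `a + 1` (next pointer).

push(e):  pushNew   choose a fresh node a; nVal := a; nNxt := a + 1
          pushVal   [nVal] := e                 (relaxed)
          pushTop   top := Top                  (acquiring)
          pushNxt   [nNxt] := top               (relaxed)
          pushCas   CAS(Top, top, nVal)         (releasing), on failure back to pushTop

pop():    popTop    top := Top                  (acquiring)
          popTest   if top = null back to popTop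
          popNxt    nTop := [top + 1]           (relaxed)
          popCas    CAS(Top, top, nTop)         (releasing), on failure back to popTop
          popRet    rval := [top]               (relaxed)  -/
inductive CRun (R : Type*) where
  | pushNew (e : Regs R → ℕ)
  | pushVal (e : Regs R → ℕ)
  | pushTop (e : Regs R → ℕ)
  | pushNxt (e : Regs R → ℕ)
  | pushCas (e : Regs R → ℕ)
  | popTop
  | popTest
  | popNxt
  | popCas
  | popRet

/-- The implementation of a method. -/
def CRun.start {R : Type*} : Meth R → CRun R
  | .push e => .pushNew e
  | .pop => .popTop

/-- The library registers of a thread. -/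
structure TReg where
  nVal : ℕ
  nNxt : ℕ
  top : ℕ
  nTop : ℕ

/-- The local state of the library as seen by a method call of one thread: its registers and
return value, and the auxiliary sets of used and of pushed addresses. -/
structure TLocal where
  reg : TReg
  rval : Option Val
  usedAddr : Set ℕ
  pushedAddr : Set ℕ

/-- Program steps of the Treiber stack. -/
inductive CRunStep {R : Type*} (ρ : Regs R) :
    CRun R → TLocal → Option (Act LLoc ℕ) → Hole (CRun R) → TLocal → Prop
  | pushNew (e : Regs R → ℕ) (s : TLocal) (a : ℕ) :
      a ≠ null → a ∉ s.usedAddr → a + 1 ∉ s.usedAddr →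
      CRunStep ρ (.pushNew e) s none (.run (.pushVal e))
        { s with
          reg := { s.reg with nVal := a, nNxt := a + 1 }
          usedAddr := s.usedAddr ∪ {a, a + 1} }
  | pushVal (e : Regs R → ℕ) (s : TLocal) :
      CRunStep ρ (.pushVal e) s (some (.wr false (.cell s.reg.nVal) (e ρ)))
        (.run (.pushTop e)) s
  | pushTop (e : Regs R → ℕ) (s : TLocal) (v : ℕ) :
      CRunStep ρ (.pushTop e) s (some (.rd true .Top v)) (.run (.pushNxt e))
        { s with reg := { s.reg with top := v } }
  | pushNxt (e : Regs R → ℕ) (s : TLocal) :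
      CRunStep ρ (.pushNxt e) s (some (.wr false (.cell s.reg.nNxt) s.reg.top))
        (.run (.pushCas e)) s
  | pushCasFail (e : Regs R → ℕ) (s : TLocal) (v : ℕ) :
      v ≠ s.reg.top →
      CRunStep ρ (.pushCas e) s (some (.rd false .Top v)) (.run (.pushTop e)) s
  | pushCasSucc (e : Regs R → ℕ) (s : TLocal) :
      CRunStep ρ (.pushCas e) s (some (.upd true false .Top s.reg.top s.reg.nVal)) (.val none)
        { s with rval := none, pushedAddr := s.pushedAddr ∪ {s.reg.nVal} }
  | popTop (s : TLocal) (v : ℕ) :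
      CRunStep ρ .popTop s (some (.rd true .Top v)) (.run .popTest)
        { s with reg := { s.reg with top := v } }
  | popTestNull (s : TLocal) :
      s.reg.top = null → CRunStep ρ .popTest s none (.run .popTop) s
  | popTest (s : TLocal) :
      s.reg.top ≠ null → CRunStep ρ .popTest s none (.run .popNxt) s
  | popNxt (s : TLocal) (v : ℕ) :
      CRunStep ρ .popNxt s (some (.rd false (.cell (s.reg.top + 1)) v)) (.run .popCas)
        { s with reg := { s.reg with nTop := v } }
  | popCasFail (s : TLocal) (v : ℕ) :
      v ≠ s.reg.top →
      CRunStep ρ .popCas s (some (.rd false .Top v)) (.run .popTop) s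
  | popCasSucc (s : TLocal) :
      CRunStep ρ .popCas s (some (.upd true false .Top s.reg.top s.reg.nTop)) (.run .popRet)
        { s with pushedAddr := s.pushedAddr \ {s.reg.top} }
  | popRet (s : TLocal) (v : ℕ) :
      CRunStep ρ .popRet s (some (.rd false (.cell s.reg.top) v)) (.val (some (.num v)))
        { s with rval := some (.num v) }

structure CState (T R X : Type*) where
  regs : T → Regs R
  rval : T → Option Val
  reg : T → TReg
  usedAddr : Set ℕ
  pushedAddr : Set ℕ
  cl : CompState T X (Act X Val) LLoc (Act LLoc ℕ)
  lib : CompState T LLoc (Act LLoc ℕ) X (Act X Val)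

structure CConf (T R X : Type*) where
  prog : T → Com R X (CRun R)
  st : CState T R X

section Concrete
variable {T R X : Type*}

/-- The library's local state as seen by thread `t`. -/
def CState.tlocal (S : CState T R X) (t : T) : TLocal :=
  ⟨S.reg t, S.rval t, S.usedAddr, S.pushedAddr⟩

def CState.setTLocal (S : CState T R X) (t : T) (s : TLocal) : CState T R X :=
  { S with
    reg := fupd S.reg t s.reg
    rval := fupd S.rval t s.rval
    usedAddr := s.usedAddr
    pushedAddr := s.pushedAddr }

/-- Steps of the client program. -/
inductive CCliStep : CConf T R X → CConf T R X → Prop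
  | eps (Ψ : CConf T R X) (t : T) (c' : Com R X (CRun R)) (ρ' : Regs R) :
      CliStep (Ψ.prog t) (Ψ.st.regs t) none c' ρ' →
      CCliStep Ψ ⟨fupd Ψ.prog t c', { Ψ.st with regs := fupd Ψ.st.regs t ρ' }⟩
  | act (Ψ : CConf T R X) (t : T) (c' : Com R X (CRun R)) (ρ' : Regs R) (a : Act X Val)
      (γ' : CompState T X (Act X Val) LLoc (Act LLoc ℕ)) (v' : View LLoc (Act LLoc ℕ)) :
      CliStep (Ψ.prog t) (Ψ.st.regs t) (some a) c' ρ' →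
      MemStep t a Ψ.st.cl (Ψ.st.lib.tview t) γ' v' →
      CCliStep Ψ ⟨fupd Ψ.prog t c', { Ψ.st with
        regs := fupd Ψ.st.regs t ρ'
        cl := γ'
        lib := Ψ.st.lib.setView t v' }⟩

/-- Steps of the Treiber stack. -/
inductive CLibStep : CConf T R X → CConf T R X → Prop
  | eps (Ψ : CConf T R X) (t : T) (d : CRun R) (h : Hole (CRun R)) (c' : Com R X (CRun R))
      (s' : TLocal) :
      HoleStep d h (Ψ.prog t) c' →
      CRunStep (Ψ.st.regs t) d (Ψ.st.tlocal t) none h s' →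
      CLibStep Ψ ⟨fupd Ψ.prog t c', Ψ.st.setTLocal t s'⟩
  | act (Ψ : CConf T R X) (t : T) (d : CRun R) (h : Hole (CRun R)) (c' : Com R X (CRun R))
      (s' : TLocal) (a : Act LLoc ℕ)
      (β' : CompState T LLoc (Act LLoc ℕ) X (Act X Val)) (v' : View X (Act X Val)) :
      HoleStep d h (Ψ.prog t) c' →
      CRunStep (Ψ.st.regs t) d (Ψ.st.tlocal t) (some a) h s' →
      MemStep t a Ψ.st.lib (Ψ.st.cl.tview t) β' v' →
      CLibStep Ψ ⟨fupd Ψ.prog t c', { Ψ.st.setTLocal t s' with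
        cl := Ψ.st.cl.setView t v'
        lib := β' }⟩

/-- Steps of the client using the Treiber stack. -/
def CStep (Ψ Ψ' : CConf T R X) : Prop := CCliStep Ψ Ψ' ∨ CLibStep Ψ Ψ'

/-- The initial configuration of a client using the Treiber stack: `Top` is null, all cells
hold `0`, no address is used. -/
def CConf.init (C : Client T R X) (k : X → Val) (l : T → Regs R) : CConf T R X where
  prog := fun t => (C t).map CRun.start
  st :=
    { regs := l
      rval := fun _ => none
      reg := fun _ => ⟨0, 0, null, 0⟩
      usedAddr := ∅
      pushedAddr := ∅
      cl := CompState.init k (fun y => (.wr false y 0, 0))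
      lib := CompState.init (fun _ => 0) (fun x => (.wr false x (k x), 0)) }

/-! ## Forward simulation -/

/-- Corresponding method calls of thread `t`: a call of the Treiber stack corresponds to an abstract
call not yet executed up to its successful CAS, and between the CAS of a pop and its return to an
abstract pop that has taken effect and returns the value stored in the popped node. -/
inductive RunCorr (S : CState T R X) (t : T) : ARun R → CRun R → Prop
  | pushNew (e : Regs R → ℕ) : RunCorr S t (.start (.push e)) (.pushNew e)
  | pushVal (e : Regs R → ℕ) : RunCorr S t (.start (.push e)) (.pushVal e)
  | pushTop (e : Regs R → ℕ) : RunCorr S t (.start (.push e)) (.pushTop e)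
  | pushNxt (e : Regs R → ℕ) : RunCorr S t (.start (.push e)) (.pushNxt e)
  | pushCas (e : Regs R → ℕ) : RunCorr S t (.start (.push e)) (.pushCas e)
  | popTop : RunCorr S t (.start .pop) .popTop
  | popTest : RunCorr S t (.start .pop) .popTest
  | popNxt : RunCorr S t (.start .pop) .popNxt
  | popCas : RunCorr S t (.start .pop) .popCas
  | popRet : RunCorr S t (.popRet (.num (S.lib.lastVal (.cell (S.reg t).top)))) .popRet

/-- The abstract and the concrete configuration are at corresponding points of the client. -/
def Corr (Ω : AConf T R X) (Ψ : CConf T R X) : Prop :=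
  ∀ t, ComCorr (RunCorr Ψ.st t) (Ω.prog t) (Ψ.prog t)

/-- `R` is a forward simulation between the abstract stack and the Treiber stack for the client
`C` with initialisation `k`, `l`. -/
structure IsForwardSimulation (C : Client T R X) (k : X → Val) (l : T → Regs R)
    (Rel : AState T R X → CState T R X → Prop) : Prop where
  /-- client observation -/
  obs : ∀ A S, Rel A S →
    A.regs = S.regs ∧
    ∀ t, (∀ x, S.cl.Obs t x ⊆ A.cl.Obs t x) ∧ A.rval t = S.rval t
  /-- initialisation -/
  init : Corr (AConf.init C k l) (CConf.init C k l) ∧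
    Rel (AConf.init C k l).st (CConf.init C k l).st
  /-- every step of the Treiber stack is a stuttering step or is matched by an abstract step -/
  step : ∀ (Ω : AConf T R X) (Ψ Ψ' : CConf T R X),
    Relation.ReflTransGen AStep (AConf.init C k l) Ω →
    Relation.ReflTransGen CStep (CConf.init C k l) Ψ →
    Corr Ω Ψ → Rel Ω.st Ψ.st → CLibStep Ψ Ψ' →
    (Corr Ω Ψ' ∧ Rel Ω.st Ψ'.st) ∨
    ∃ Ω', AStep Ω Ω' ∧ Corr Ω' Ψ' ∧ Rel Ω'.st Ψ'.st

/-- The value of a push. -/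
def StackAct.pushVal : StackAct → Option ℕ
  | push _ u => some u
  | pop _ _ => none

/-- The simulation relation between the abstract stack and the Treiber stack. -/
def RTS (A : AState T R X) (S : CState T R X) : Prop :=
  -- both sides have the same client registers, return values, and client operations
  A.regs = S.regs ∧ A.rval = S.rval ∧ A.cl.ops = S.cl.ops ∧ A.cl.cvd = S.cl.cvd ∧
  ∃ f : ℕ → StackAct × ℚ,
    -- `f` is injective and maps null to a pop that returns empty
    Set.InjOn f (insert null S.pushedAddr) ∧
    (∃ b ts, f null = (.pop b .empty, ts)) ∧
    -- a pushed address is mapped to an unmatched push of the same value, later than the push of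
    -- the next node
    (∀ a ∈ S.pushedAddr, f a ∈ A.lib.unmatchedPush ∧
      (f a).1.pushVal = some (S.lib.lastVal (.cell a)) ∧
      tst (f (S.lib.lastVal (.cell (a + 1)))) < tst (f a)) ∧
    -- no unmatched push lies between a node and its next node
    (∀ a ∈ S.pushedAddr, ∀ op ∈ A.lib.unmatchedPush,
      op ≠ f a → op ≠ f (S.lib.lastVal (.cell (a + 1))) →
      tst op < tst (f (S.lib.lastVal (.cell (a + 1)))) ∨ tst (f a) < tst op) ∧
    -- if the stack is nonempty, its top node is the last unmatched push
    (S.lib.lastVal .Top ≠ null →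
      f (S.lib.lastVal .Top) ∈ A.lib.unmatchedPush ∧
      ∀ op ∈ A.lib.unmatchedPush, tst op ≤ tst (f (S.lib.lastVal .Top))) ∧
    -- a thread that has obtained a pushed address from `Top` has seen the client operations
    -- recorded by the corresponding push
    (∀ t, ∀ a ∈ S.pushedAddr, (S.reg t).top = a →
      ∀ x, tst (A.lib.mviewCtx (f a) x) ≤ tst (S.cl.tview t x)) ∧
    -- so has every write of a pushed address to `Top`
    (∀ a ∈ S.pushedAddr, ∀ w ∈ S.lib.ops, w.1.loc = .Top → w.1.wrval = some a →
      ∀ x, tst (A.lib.mviewCtx (f a) x) ≤ tst (S.lib.mviewCtx w x)) ∧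
    -- no thread's client view is earlier on the concrete side
    (∀ t x, tst (A.cl.tview t x) ≤ tst (S.cl.tview t x))

end Concrete

end TreiberC11

end

noncomputable section

namespace TreiberC11

open CompState

/-! ## Function update, views, memory steps -/

/-! `RTS` says nothing about what the library views of the threads contain, so it is not carried by
itself. The proof adds an invariant `CConf.OK` of the concrete side alone, kept by every client step
and every library step. It rests on three facts.

After initialisation `Top` is changed only by updates, and an update covers the operation that it
reads. So an uncovered operation on `Top` is a last write, a successful CAS reads the last value of
`Top`, and the values of `Top` form one sequential history (`CConf.OK.casStep`).

A node is written only by the thread that allocated it, before its address is first written to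
`Top`, and used addresses are never allocated again. So the cells of every node whose address was
ever written to `Top` are frozen, even after the node has been popped (`CConf.OK.writeStep`).

Every write of a non-null address `a` to `Top` is releasing, and its recorded view contains the last
writes to both cells of `a` as well as the recorded view of some write of the next node to `Top`
(`LibState.Knows`). After an acquiring read of `Top` the relaxed reads of the cells of the node
therefore return their final values, whatever has happened to `Top` in between. The CAS of a pop
does not acquire anything, but its thread already holds the recorded view of a write of the next
node, so the property passes on to the new write.

Consequently the pushed addresses are always the list read off from `Top`, and a successful CAS adds
or removes its head. Library steps have only four kinds of effect (`LibEvent`): quiet steps stutter,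
the return of a pop is matched by the abstract return, and a successful CAS by an abstract push or
pop. The abstract operation is placed later than every existing timestamp, which avoids all matched
intervals. A push extends `f` by the new operation (`StackMap.push`). A pop keeps `f`
(`StackMap.pop`): since no unmatched push lies between a node and the next one, the next node
becomes the last unmatched push.

As to the client views, an abstract pop joins at most the client view of the push into that of its
thread. On the concrete side the thread has already seen a write of the popped node to `Top`, whose
recorded client view is at least as late. So concrete client views remain the later ones, which is
what the inclusion of observable writes needs. -/

theorem fupd_same {α β : Type*} (f : α → β) (a : α) (b : β) : fupd f a b a = b := by
  simp [fupd]

theorem fupd_ne {α β : Type*} (f : α → β) {a x : α} (b : β) (h : x ≠ a) :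
    fupd f a b x = f x := by
  simp [fupd, h]

theorem fupd_self {α β : Type*} (f : α → β) (a : α) : fupd f a (f a) = f := by
  funext x
  by_cases h : x = a
  · subst h; exact fupd_same _ _ _
  · exact fupd_ne _ _ h

/-- The view `V` is pointwise not later than `V'`. -/
def View.Le {L A : Type*} (V V' : View L A) : Prop := ∀ x, tst (V x) ≤ tst (V' x)

namespace View
variable {L A : Type*} {V V' V₁ V₂ W : View L A}

theorem Le.refl (V : View L A) : V.Le V := fun _ => le_rfl

theorem Le.trans (h : V.Le V') (h' : V'.Le W) : V.Le W := fun x => (h x).trans (h' x)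

theorem tst_join (V₁ V₂ : View L A) (x : L) :
    tst (View.join V₁ V₂ x) = max (tst (V₁ x)) (tst (V₂ x)) := by
  unfold View.join
  split_ifs with h
  · exact (max_eq_left h).symm
  · exact (max_eq_right (le_of_not_ge h)).symm

theorem le_join_left (V₁ V₂ : View L A) : V₁.Le (View.join V₁ V₂) := fun x => by
  rw [tst_join]; exact le_max_left _ _

theorem le_join_right (V₁ V₂ : View L A) : V₂.Le (View.join V₁ V₂) := fun x => by
  rw [tst_join]; exact le_max_right _ _

theorem join_le (h₁ : V₁.Le W) (h₂ : V₂.Le W) : (View.join V₁ V₂).Le W := fun x => by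
  rw [tst_join]; exact max_le (h₁ x) (h₂ x)

theorem le_fupd {x : L} {w : A × ℚ} (h : tst (V x) ≤ tst w) : V.Le (fupd V x w) := fun y => by
  by_cases hy : y = x
  · subst hy; rw [fupd_same]; exact h
  · rw [fupd_ne _ _ hy]

end View

theorem le_fupd_views {T L A : Type*} {f : T → View L A} {t : T} {V : View L A}
    (h : (f t).Le V) (t' : T) : (f t').Le (fupd f t V t') := by
  by_cases ht : t' = t
  · subst ht; rw [fupd_same]; exact h
  · rw [fupd_ne _ _ ht]; exact View.Le.refl _

/-! ### Last writes, and the effect of introducing one operation -/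

namespace CompState
variable {T L L' A' V : Type*}

/-- No operation on `x` is later than `q`. -/
def Latest (γ : CompState T L (Act L V) L' A') (x : L) (q : ℚ) : Prop :=
  ∀ w ∈ γ.ops, w.1.loc = x → tst w ≤ q

/-- Both states have the same operations on `x`. -/
def Same (γ γ' : CompState T L (Act L V) L' A') (x : L) : Prop :=
  ∀ w, w.1.loc = x → (w ∈ γ'.ops ↔ w ∈ γ.ops)

/-- Operations on the same location have distinct timestamps. -/
def Uniq (γ : CompState T L (Act L V) L' A') : Prop :=
  ∀ w ∈ γ.ops, ∀ w' ∈ γ.ops, w.1.loc = w'.1.loc → tst w = tst w' → w = w'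

/-- The state after the thread `t` has introduced the operation `e`. -/
def extend (γ : CompState T L (Act L V) L' A') (t : T) (e : Act L V × ℚ) (tv : View L (Act L V))
    (cvd : Set (Act L V × ℚ)) (v : View L' A') : CompState T L (Act L V) L' A' where
  ops := γ.ops ∪ {e}
  tview := fupd γ.tview t tv
  mview := fupd γ.mview e tv
  mviewCtx := fupd γ.mviewCtx e v
  cvd := cvd

variable {γ γ' : CompState T L (Act L V) L' A'} {x y : L} {t : T} {e w : Act L V × ℚ} {q : ℚ}

theorem Latest.mono {q' : ℚ} (h : γ.Latest x q) (hq : q ≤ q') : γ.Latest x q' :=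
  fun w hw hx => (h w hw hx).trans hq

theorem Same.latest (h : Same γ γ' x) (hl : γ.Latest x q) : γ'.Latest x q :=
  fun w hw hx => hl w ((h w hx).1 hw) hx

theorem Same.of_ops (h : γ'.ops = γ.ops) : Same γ γ' x := fun w _ => by rw [h]

theorem Same.isLast_iff (h : Same γ γ' x) (w : Act L V × ℚ) : γ'.IsLast x w ↔ γ.IsLast x w := by
  constructor
  · rintro ⟨h₁, h₂, h₃⟩
    exact ⟨(h w h₂).1 h₁, h₂, fun w' hw' hx => h₃ w' ((h w' hx).2 hw') hx⟩
  · rintro ⟨h₁, h₂, h₃⟩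
    exact ⟨(h w h₂).2 h₁, h₂, fun w' hw' hx => h₃ w' ((h w' hx).1 hw') hx⟩

theorem Same.lastVal_eq [Nonempty V] (h : Same γ γ' x) : γ'.lastVal x = γ.lastVal x := by
  unfold lastVal
  simp only [h.isLast_iff]

/-- `lastVal` is an arbitrary choice among last writes; distinct timestamps on a location leave only
one candidate. -/
theorem lastVal_eq [Nonempty V] (hu : γ.Uniq) {n : V} (hw : w ∈ γ.ops) (hx : w.1.loc = x)
    (hl : γ.Latest x (tst w)) (hn : w.1.wrval = some n) : γ.lastVal x = n := by
  have hex : ∃ v, ∃ w, γ.IsLast x w ∧ w.1.wrval = some v := ⟨n, w, ⟨hw, hx, hl⟩, hn⟩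
  obtain ⟨w', ⟨h₁, h₂, h₃⟩, h₄⟩ := Classical.epsilon_spec hex
  have : w' = w := hu w' h₁ w hw (h₂.trans hx.symm) (le_antisymm (hl w' h₁ h₂) (h₃ w hw hx))
  rw [this, hn] at h₄
  exact (Option.some.inj h₄).symm

/-- An operation at the fresh timestamp would lie after `q`, hence by freshness after itself. -/
theorem Fresh.ne {q' : ℚ} (h : γ.Fresh q q') (hw : w ∈ γ.ops) : tst w ≠ q' := by
  intro he
  have h₁ : q < tst w := by rw [he]; exact h.1
  exact (h.2 w hw h₁).ne he.symm

theorem Fresh.not_mem {q' : ℚ} (h : γ.Fresh q q') (he : tst e = q') : e ∉ γ.ops :=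
  fun hw => h.ne hw he

section extend
variable {tv : View L (Act L V)} {cvd : Set (Act L V × ℚ)} {v : View L' A'}

theorem mem_extend : w ∈ (γ.extend t e tv cvd v).ops ↔ w ∈ γ.ops ∨ w = e := Iff.rfl

theorem same_extend (h : e.1.loc ≠ y) : Same γ (γ.extend t e tv cvd v) y := fun w hw => by
  rw [mem_extend]
  refine ⟨fun hm => hm.resolve_right ?_, Or.inl⟩
  rintro rfl
  exact h hw

/-- Freshness excludes the timestamps of all operations of the component, not only of those on the
same location. -/
theorem uniq_extend (hu : γ.Uniq) (hf : γ.Fresh q (tst e)) :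
    (γ.extend t e tv cvd v).Uniq := by
  rintro w (hw | rfl) w' (hw' | rfl) hl ht
  · exact hu w hw w' hw' hl ht
  · exact (hf.ne hw ht).elim
  · exact (hf.ne hw' ht.symm).elim
  · rfl

theorem latest_extend (hf : γ.Fresh q (tst e)) (hl : γ.Latest x q) :
    (γ.extend t e tv cvd v).Latest x (tst e) := by
  rintro w (hw | rfl) hx
  · exact (hl w hw hx).trans hf.1.le
  · exact le_rfl

theorem mview_extend (he : e ∉ γ.ops) (hw : w ∈ γ.ops) :
    (γ.extend t e tv cvd v).mview w = γ.mview w :=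
  fupd_ne _ _ fun h => he (h ▸ hw)

theorem mviewCtx_extend (he : e ∉ γ.ops) (hw : w ∈ γ.ops) :
    (γ.extend t e tv cvd v).mviewCtx w = γ.mviewCtx w :=
  fupd_ne _ _ fun h => he (h ▸ hw)

end extend

end CompState

section MemStep
open CompState
variable {T L V L' A' : Type*} {γ γ' : CompState T L (Act L V) L' A'} {v v' : View L' A'}
  {t : T} {x : L}

/-- Observable operations are never earlier than the view of the thread, new ones are placed after
an observable one, and joins only move views forward. -/
theorem MemStep.views_le {a : Act L V} (h : MemStep t a γ v γ' v') :
    (∀ t', (γ.tview t').Le (γ'.tview t')) ∧ v.Le v' := by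
  cases h with
  | read _ _ acq x n w hw hn =>
    refine ⟨le_fupd_views ?_, ?_⟩
    · split_ifs
      · exact View.le_join_left _ _
      · exact View.le_fupd hw.2.2
    · split_ifs
      · exact View.le_join_left _ _
      · exact View.Le.refl _
  | write _ _ rel x n w q' e tv hw hc hf he htv =>
    subst he htv
    exact ⟨le_fupd_views (View.le_fupd (hw.2.2.trans hf.1.le)), View.Le.refl _⟩
  | updateRA _ _ x m n w q' e tv _ hw hc hm hf he htv hv =>
    subst he htv hv
    refine ⟨le_fupd_views ?_, ?_⟩
    · have := View.le_fupd (hw.2.2.trans hf.1.le : tst _ ≤ tst (Act.upd true true x m n, q'))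
      split_ifs
      · exact this.trans (View.le_join_left _ _)
      · exact this
    · split_ifs
      · exact View.le_join_left _ _
      · exact View.Le.refl _
  | updateRel _ _ x m n w q' e tv hw hc hm hf he htv =>
    subst he htv
    exact ⟨le_fupd_views (View.le_fupd (hw.2.2.trans hf.1.le)), View.Le.refl _⟩

/-- The new views are kept only through lower bounds, which suffice for the invariants and treat
relaxed and acquiring reads alike. -/
theorem MemStep.read_inv {acq : Bool} {n : V} (h : MemStep t (.rd acq x n) γ v γ' v') :
    ∃ w ∈ γ.Obs t x, w.1.wrval = some n ∧ ∃ tv, γ' = γ.setView t tv ∧ (γ.tview t).Le tv ∧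
      v.Le v' ∧ (w.1.IsRel → acq = true → (γ.mview w).Le tv ∧ (γ.mviewCtx w).Le v') := by
  have hle := h.views_le
  cases h with
  | read _ _ acq x n w hw hn =>
    refine ⟨w, hw, hn, _, rfl, ?_, hle.2, fun hr ha => ?_⟩
    · have := hle.1 t
      simpa only [setView, fupd_same] using this
    · rw [if_pos ⟨hr, ha⟩, if_pos ⟨hr, ha⟩]
      exact ⟨View.le_join_right _ _, View.le_join_right _ _⟩

theorem MemStep.write_inv {rel : Bool} {n : V} (h : MemStep t (.wr rel x n) γ v γ' v') :
    v' = v ∧ ∃ w ∈ γ.Obs t x, ∃ q', γ.Fresh (tst w) q' ∧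
      γ' = γ.extend t (.wr rel x n, q') (fupd (γ.tview t) x (.wr rel x n, q')) γ.cvd v := by
  cases h with
  | write _ _ rel x n w q' e tv hw hc hf he htv =>
    subst he htv
    exact ⟨rfl, w, hw, q', hf, rfl⟩

theorem MemStep.updateRel_inv {m n : V} (h : MemStep t (.upd true false x m n) γ v γ' v') :
    v' = v ∧ ∃ w ∈ γ.Obs t x, w ∉ γ.cvd ∧ w.1.wrval = some m ∧ ∃ q', γ.Fresh (tst w) q' ∧
      γ' = γ.extend t (.upd true false x m n, q')
        (fupd (γ.tview t) x (.upd true false x m n, q')) (γ.cvd ∪ {w}) v := by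
  cases h with
  | updateRel _ _ x m n w q' e tv hw hc hm hf he htv =>
    subst he htv
    exact ⟨rfl, w, hw, hc, hm, q', hf, rfl⟩

end MemStep

/-! ## Programs with a single active hole -/

section Programs
variable {R X D D' : Type*}

/-- Every call in progress satisfies `P`. -/
def Com.AllRun (P : D → Prop) : Com R X D → Prop
  | .call (.run d) => P d
  | .callTo _ (.run d) => P d
  | .seq c₁ c₂ => c₁.AllRun P ∧ c₂.AllRun P
  | .ite _ c₁ c₂ => c₁.AllRun P ∧ c₂.AllRun P
  | .while _ c => c.AllRun P
  | _ => True

/-- Every call in progress outside the active hole satisfies `P`. -/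
def Com.InactiveRun (P : D → Prop) : Com R X D → Prop
  | .seq c₁ c₂ => c₁.InactiveRun P ∧ c₂.AllRun P
  | .ite _ c₁ c₂ => c₁.AllRun P ∧ c₂.AllRun P
  | .while _ c => c.AllRun P
  | _ => True

/-- The method call running in a hole. -/
def Hole.active : Hole D → Option D
  | .run d => some d
  | .val _ => none

/-- The method call in the active hole. -/
def Com.active : Com R X D → Option D
  | .call h => h.active
  | .callTo _ h => h.active
  | .seq c _ => c.active
  | _ => none

variable {P : D → Prop} {c c' : Com R X D} {d : D} {h : Hole D}

theorem Com.AllRun.inactiveRun (hc : c.AllRun P) :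
    c.InactiveRun P ∧ ∀ d, c.active = some d → P d := by
  induction c with
  | call h =>
    cases h with
    | run d => exact ⟨trivial, fun d' hd => Option.some.inj hd ▸ hc⟩
    | val v => exact ⟨trivial, fun d' hd => nomatch hd⟩
  | callTo r h =>
    cases h with
    | run d => exact ⟨trivial, fun d' hd => Option.some.inj hd ▸ hc⟩
    | val v => exact ⟨trivial, fun d' hd => nomatch hd⟩
  | seq c₁ c₂ ih₁ _ => exact ⟨⟨(ih₁ hc.1).1, hc.2⟩, (ih₁ hc.1).2⟩
  | _ => exact ⟨hc, fun d' hd => nomatch hd⟩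

theorem Com.allRun_map {f : D' → D} (hf : ∀ d, P (f d)) (c : Com R X D') :
    (c.map f).AllRun P := by
  induction c with
  | call h =>
    cases h with
    | run d => exact hf d
    | val v => trivial
  | callTo r h =>
    cases h with
    | run d => exact hf d
    | val v => trivial
  | seq c₁ c₂ ih₁ ih₂ => exact ⟨ih₁, ih₂⟩
  | ite b c₁ c₂ ih₁ ih₂ => exact ⟨ih₁, ih₂⟩
  | _ => trivial

/-- No client rule applies to a running call, and a call that becomes active was inactive before the
step, so it still satisfies `P`. With `P` meaning "not yet begun", client steps never disturb a call
in progress. -/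
theorem CliStep.inactiveRun {ρ ρ' : Regs R} {a : Option (Act X Val)}
    (h : CliStep c ρ a c' ρ') (hc : c.InactiveRun P) :
    c.active = none ∧ c'.InactiveRun P ∧ ∀ d, c'.active = some d → P d := by
  induction h with
  | seq c₁ c₁' c₂ ρ ρ' a _ ih =>
    obtain ⟨h₁, h₂, h₃⟩ := ih hc.1
    exact ⟨h₁, ⟨h₂, hc.2⟩, h₃⟩
  | seqSkip c₂ ρ => exact ⟨rfl, hc.2.inactiveRun⟩
  | iteTrue b c₁ c₂ ρ _ => exact ⟨rfl, hc.1.inactiveRun⟩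
  | iteFalse b c₁ c₂ ρ _ => exact ⟨rfl, hc.2.inactiveRun⟩
  | whileTrue b c ρ _ =>
    have hc' : c.AllRun P := hc
    exact ⟨rfl, ⟨hc'.inactiveRun.1, hc⟩, hc'.inactiveRun.2⟩
  | _ => exact ⟨rfl, trivial, fun d hd => nomatch hd⟩

theorem HoleStep.inactiveRun (hs : HoleStep d h c c') (hc : c.InactiveRun P) :
    c.active = some d ∧ c'.active = h.active ∧ c'.InactiveRun P := by
  induction hs with
  | call => exact ⟨rfl, rfl, trivial⟩
  | callTo r => exact ⟨rfl, rfl, trivial⟩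
  | seq c₁ c₁' c₂ _ ih =>
    obtain ⟨h₁, h₂, h₃⟩ := ih hc.1
    exact ⟨h₁, h₂, h₃, hc.2⟩

/-- For stuttering steps: putting the same abstract call back leaves the abstract program unchanged.
-/
theorem HoleStep.eq_of_run (hs : HoleStep d (.run d) c c') : c' = c := by
  generalize hh : Hole.run d = h at hs
  induction hs with
  | call => rw [hh]
  | callTo r => rw [hh]
  | seq c₁ c₁' c₂ _ ih => rw [ih]

theorem ComCorr.mono_allRun {rel rel' : D' → D → Prop} {a : Com R X D'} (hc : c.AllRun P)
    (hP : ∀ d' d, P d → rel d' d → rel' d' d) (hcorr : ComCorr rel a c) :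
    ComCorr rel' a c := by
  induction hcorr with
  | skip => exact .skip
  | assign r e => exact .assign r e
  | write b x e => exact .write b x e
  | read b r x => exact .read b r x
  | cas b b' r x u v => exact .cas b b' r x u v
  | fai b b' r x => exact .fai b b' r x
  | callRun d d' hd => exact .callRun _ _ (hP _ _ hc hd)
  | callVal v => exact .callVal v
  | callToRun r d d' hd => exact .callToRun _ _ _ (hP _ _ hc hd)
  | callToVal r v => exact .callToVal r v
  | seq c₁ c₂ c₁' c₂' _ _ ih₁ ih₂ => exact .seq _ _ _ _ (ih₁ hc.1) (ih₂ hc.2)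
  | ite b c₁ c₂ c₁' c₂' _ _ ih₁ ih₂ => exact .ite _ _ _ _ _ (ih₁ hc.1) (ih₂ hc.2)
  | _ => rename_i ih; exact .while _ _ _ (ih hc)

/-- In the simulation `rel` depends on the memory state. Calls outside the active hole have not
begun and are transferred through `P`; only the active call needs an argument about the state. -/
theorem ComCorr.mono {rel rel' : D' → D → Prop} {a : Com R X D'} (hc : c.InactiveRun P)
    (hP : ∀ d' d, P d → rel d' d → rel' d' d)
    (hact : ∀ d' d, c.active = some d → rel d' d → rel' d' d) (hcorr : ComCorr rel a c) :
    ComCorr rel' a c := by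
  induction hcorr with
  | skip => exact .skip
  | assign r e => exact .assign r e
  | write b x e => exact .write b x e
  | read b r x => exact .read b r x
  | cas b b' r x u v => exact .cas b b' r x u v
  | fai b b' r x => exact .fai b b' r x
  | callRun d d' hd => exact .callRun _ _ (hact _ _ rfl hd)
  | callVal v => exact .callVal v
  | callToRun r d d' hd => exact .callToRun _ _ _ (hact _ _ rfl hd)
  | callToVal r v => exact .callToVal r v
  | seq c₁ c₂ c₁' c₂' _ h₂ ih₁ _ =>
    exact .seq _ _ _ _ (ih₁ hc.1 hact) (h₂.mono_allRun hc.2 hP)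
  | ite b c₁ c₂ c₁' c₂' h₁ h₂ _ _ =>
    exact .ite _ _ _ _ _ (h₁.mono_allRun hc.1 hP) (h₂.mono_allRun hc.2 hP)
  | _ => rename_i h _; exact .while _ _ _ (h.mono_allRun hc hP)

/-- Corresponding contents of holes. -/
inductive HoleCorr (rel : D' → D → Prop) : Hole D' → Hole D → Prop
  | run (d' : D') (d : D) : rel d' d → HoleCorr rel (.run d') (.run d)
  | val (v : Option Val) : HoleCorr rel (.val v) (.val v)

/-- Corresponding programs have their active holes at the same place. The new abstract contents `h'`
stay free, so that one lemma serves stuttering, effects and returns. -/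
theorem ComCorr.holeStep {rel rel' : D' → D → Prop} {a : Com R X D'} (hc : c.InactiveRun P)
    (hP : ∀ d' d, P d → rel d' d → rel' d' d) (hs : HoleStep d h c c')
    (hcorr : ComCorr rel a c) :
    ∃ d', rel d' d ∧ ∀ h', HoleCorr rel' h' h → ∃ a', HoleStep d' h' a a' ∧ ComCorr rel' a' c' := by
  induction hs generalizing a with
  | call =>
    cases hcorr with
    | callRun d' _ hd =>
      refine ⟨d', hd, fun h' hh => ⟨_, .call, ?_⟩⟩
      cases hh with
      | run d₁ d₂ hd => exact .callRun _ _ hd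
      | val v => exact .callVal v
  | callTo r =>
    cases hcorr with
    | callToRun _ d' _ hd =>
      refine ⟨d', hd, fun h' hh => ⟨_, .callTo r, ?_⟩⟩
      cases hh with
      | run d₁ d₂ hd => exact .callToRun _ _ _ hd
      | val v => exact .callToVal r v
  | seq c₁ c₁' c₂ _ ih =>
    cases hcorr with
    | seq a₁ a₂ _ _ h₁ h₂ =>
      obtain ⟨d', hd, hh⟩ := ih hc.1 h₁
      refine ⟨d', hd, fun h' hc' => ?_⟩
      obtain ⟨a', hs', ha'⟩ := hh h' hc'
      exact ⟨_, .seq _ _ _ hs', .seq _ _ _ _ ha' (h₂.mono_allRun hc.2 hP)⟩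

theorem ComCorr.map {M : Type*} {rel : D' → D → Prop} {f : M → D'} {g : M → D}
    (hfg : ∀ m, rel (f m) (g m)) (c : Com R X M) : ComCorr rel (c.map f) (c.map g) := by
  induction c with
  | skip => exact .skip
  | assign r e => exact .assign r e
  | write b x e => exact .write b x e
  | read b r x => exact .read b r x
  | cas b b' r x u v => exact .cas b b' r x u v
  | fai b b' r x => exact .fai b b' r x
  | call h =>
    cases h with
    | run d => exact .callRun _ _ (hfg d)
    | val v => exact .callVal v
  | callTo r h =>
    cases h with
    | run d => exact .callToRun _ _ _ (hfg d)
    | val v => exact .callToVal r v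
  | seq c₁ c₂ ih₁ ih₂ => exact .seq _ _ _ _ ih₁ ih₂
  | ite b c₁ c₂ ih₁ ih₂ => exact .ite _ _ _ _ _ ih₁ ih₂
  | _ => rename_i ih; exact .while _ _ _ ih

end Programs

/-! ## Invariants of the Treiber stack -/

/-- `IsStack next a l`: following `next` from `a`, the list `l` of addresses is traversed until the
null pointer is reached. -/
inductive IsStack (next : ℕ → ℕ) : ℕ → List ℕ → Prop
  | nil : IsStack next null []
  | cons (a : ℕ) (l : List ℕ) : a ≠ null → a ∉ l → IsStack next (next a) l →
      IsStack next a (a :: l)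

namespace IsStack
variable {next next' : ℕ → ℕ} {a b : ℕ} {l : List ℕ}

theorem congr (h : IsStack next a l) (hn : ∀ b ∈ l, next' b = next b) : IsStack next' a l := by
  induction h with
  | nil => exact .nil
  | cons a l ha hl _ ih =>
    refine .cons a l ha hl ?_
    rw [hn a (by simp)]
    exact ih fun b hb => hn b (by simp [hb])

theorem mem (h : IsStack next a l) (ha : a ≠ null) : a ∈ l := by
  cases h with
  | nil => exact (ha rfl).elim
  | cons => simp

theorem next_mem (h : IsStack next a l) (hb : b ∈ l) (hn : next b ≠ null) : next b ∈ l := by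
  induction h with
  | nil => simp at hb
  | cons a l _ _ hs ih =>
    rcases List.mem_cons.1 hb with rfl | hb
    · exact List.mem_cons_of_mem _ (hs.mem hn)
    · exact List.mem_cons_of_mem _ (ih hb)

theorem eq_nil (h : IsStack next null l) : l = [] := by
  cases h with
  | nil => rfl
  | cons _ _ h => exact (h rfl).elim

end IsStack

/-- The nodes `a` and `b` occupy disjoint cells. -/
def Sep (a b : ℕ) : Prop := a ≠ b ∧ a ≠ b + 1 ∧ a + 1 ≠ b

theorem Sep.symm {a b : ℕ} (h : Sep a b) : Sep b a :=
  ⟨h.1.symm, fun h' => h.2.2 h'.symm, fun h' => h.2.1 h'.symm⟩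

theorem sep_of_not_mem {U : Set ℕ} {a b : ℕ} (ha : a ∉ U) (ha' : a + 1 ∉ U) (hb : b ∈ U)
    (hb' : b + 1 ∈ U) : Sep a b :=
  ⟨fun h => ha (h ▸ hb), fun h => ha (h ▸ hb'), fun h => ha' (h ▸ hb)⟩

section Library
variable {T X : Type*}

/-- The memory state of the library of a client with variables `X`. -/
abbrev LibState (T X : Type*) := CompState T LLoc (Act LLoc ℕ) X (Act X Val)

/-! ### What a view contains about a node -/

namespace LibState

/-- The operation `w` writes the address `a` to `Top`. -/
def TopWrite (β : LibState T X) (w : Act LLoc ℕ × ℚ) (a : ℕ) : Prop :=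
  w ∈ β.ops ∧ w.1.loc = .Top ∧ w.1.wrval = some a ∧ a ≠ null

/-- The next pointer of the node `a`. -/
def next (β : LibState T X) (a : ℕ) : ℕ := β.lastVal (.cell (a + 1))

/-- The view `V` includes the last writes to the cells of the node `a`. -/
def KnowsNode (β : LibState T X) (V : View LLoc (Act LLoc ℕ)) (a : ℕ) : Prop :=
  β.Latest (.cell a) (tst (V (.cell a))) ∧ β.Latest (.cell (a + 1)) (tst (V (.cell (a + 1))))

/-- The views `V` of the library and `V'` of the client include those of some write of `a` to
`Top`. -/
def Saw (β : LibState T X) (V : View LLoc (Act LLoc ℕ)) (V' : View X (Act X Val)) (a : ℕ) : Prop :=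
  ∃ w, β.TopWrite w a ∧ (β.mview w).Le V ∧ (β.mviewCtx w).Le V'

/-- The node `a` is allocated, its contents are included in the view `V`, and so is a write of
its next node to `Top`. -/
def Knows (β : LibState T X) (U : Set ℕ) (V : View LLoc (Act LLoc ℕ)) (V' : View X (Act X Val))
    (a : ℕ) : Prop :=
  a ∈ U ∧ a + 1 ∈ U ∧ β.KnowsNode V a ∧ (β.next a ≠ null → β.Saw V V' (β.next a))

variable {β β' : LibState T X} {U U' : Set ℕ} {V W : View LLoc (Act LLoc ℕ)}
  {V' W' : View X (Act X Val)} {a : ℕ}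

theorem KnowsNode.mono (h : β.KnowsNode V a) (hV : V.Le W) : β.KnowsNode W a :=
  ⟨h.1.mono (hV _), h.2.mono (hV _)⟩

theorem KnowsNode.of_same (h : β.KnowsNode V a) (h₁ : Same β β' (.cell a))
    (h₂ : Same β β' (.cell (a + 1))) : β'.KnowsNode V a :=
  ⟨h₁.latest h.1, h₂.latest h.2⟩

theorem Saw.mono (h : β.Saw V V' a) (hV : V.Le W) (hV' : V'.Le W') : β.Saw W W' a := by
  obtain ⟨w, hw, h₁, h₂⟩ := h
  exact ⟨w, hw, h₁.trans hV, h₂.trans hV'⟩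

theorem Knows.mono (h : β.Knows U V V' a) (hV : V.Le W) (hV' : V'.Le W') : β.Knows U W W' a :=
  ⟨h.1, h.2.1, h.2.2.1.mono hV, fun hn => (h.2.2.2 hn).mono hV hV'⟩

end LibState

end Library

section Invariants
variable {T R X : Type*}

/-- The change from `S` to `S'` by a library step of the thread `t`: views and memory grow, while
the nodes whose addresses were written to `Top` and the other threads' registers are kept. -/
structure CState.Evolves (t : T) (S S' : CState T R X) : Prop where
  regs : S'.regs = S.regs
  reg : ∀ t', t' ≠ t → S'.reg t' = S.reg t'
  cl_ops : S'.cl.ops = S.cl.ops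
  cl_cvd : S'.cl.cvd = S.cl.cvd
  lib_le : ∀ t', (S.lib.tview t').Le (S'.lib.tview t')
  cl_le : ∀ t', (S.cl.tview t').Le (S'.cl.tview t')
  ops : S.lib.ops ⊆ S'.lib.ops
  mview : ∀ w ∈ S.lib.ops, S'.lib.mview w = S.lib.mview w
  mviewCtx : ∀ w ∈ S.lib.ops, S'.lib.mviewCtx w = S.lib.mviewCtx w
  used : S.usedAddr ⊆ S'.usedAddr
  node : ∀ w a, LibState.TopWrite S.lib w a →
    Same S.lib S'.lib (.cell a) ∧ Same S.lib S'.lib (.cell (a + 1))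
  uniq : S'.lib.Uniq
  unalloc : ∀ a ∉ S'.usedAddr, Same S.lib S'.lib (.cell a)

/-- A library step that changes neither `Top` nor the set of pushed addresses. -/
structure CState.Quiet (t : T) (S S' : CState T R X) : Prop extends S.Evolves t S' where
  top : Same S.lib S'.lib .Top
  cvd : S'.lib.cvd = S.lib.cvd
  pushed : S'.pushedAddr = S.pushedAddr

/-- A successful CAS of the thread `t`, which writes `a` to `Top`. -/
structure CState.Cas (t : T) (a : ℕ) (S S' : CState T R X) : Prop extends S.Evolves t S' where
  reg_eq : S'.reg = S.reg
  cell : ∀ c, Same S.lib S'.lib (.cell c)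
  old_top : S.lib.lastVal .Top = (S.reg t).top
  new_top : S'.lib.lastVal .Top = a
  new : ∀ w ∈ S'.lib.ops, w ∉ S.lib.ops →
    w.1.wrval = some a ∧ S'.lib.mviewCtx w = S.cl.tview t

/-- The invariant of the memory state. -/
structure CState.MemOK (S : CState T R X) : Prop where
  uniq : S.lib.Uniq
  -- Updates cover what they read, so at most one operation on `Top` stays uncovered; a CAS must act
  -- on it.
  top_last : ∀ w ∈ S.lib.ops, w.1.loc = .Top → w ∉ S.lib.cvd → S.lib.Latest .Top (tst w)
  -- This ranges over all writes to `Top`, not only those of nodes still on the stack: a thread may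
  -- hold a popped address.
  top_write : ∀ w a, LibState.TopWrite S.lib w a → w.1.IsRel ∧
    LibState.Knows S.lib S.usedAddr (S.lib.mview w) (S.lib.mviewCtx w) a
  reg_top : ∀ t, (S.reg t).top ≠ null →
    LibState.Saw S.lib (S.lib.tview t) (S.cl.tview t) (S.reg t).top
  -- Makes the owner of a freshly allocated node know its two cells without any synchronisation.
  unalloc : ∀ a ∉ S.usedAddr, ∀ t, S.lib.Latest (.cell a) (tst (S.lib.tview t (.cell a)))
  chain : ∃ l, IsStack (LibState.next S.lib) (S.lib.lastVal .Top) l ∧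
    ∀ a, a ∈ S.pushedAddr ↔ a ∈ l
  pushed : ∀ a ∈ S.pushedAddr, ∃ w, LibState.TopWrite S.lib w a

/-- The thread `t` owns an allocated node that is not yet on the stack. -/
def CState.Owns (S : CState T R X) (t : T) : Prop :=
  (S.reg t).nVal ≠ null ∧ (S.reg t).nNxt = (S.reg t).nVal + 1 ∧
  (S.reg t).nVal ∈ S.usedAddr ∧ (S.reg t).nVal + 1 ∈ S.usedAddr ∧
  LibState.KnowsNode S.lib (S.lib.tview t) (S.reg t).nVal ∧
  ∀ w a, LibState.TopWrite S.lib w a → Sep (S.reg t).nVal a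

/-- The invariant of a method call of the thread `t`. -/
def CState.RunOK (S : CState T R X) (t : T) : CRun R → Prop
  | .pushVal _ => S.Owns t
  | .pushTop e => S.Owns t ∧ S.lib.lastVal (.cell (S.reg t).nVal) = e (S.regs t)
  | .pushNxt e => S.Owns t ∧ S.lib.lastVal (.cell (S.reg t).nVal) = e (S.regs t)
  | .pushCas e => S.Owns t ∧ S.lib.lastVal (.cell (S.reg t).nVal) = e (S.regs t) ∧
      LibState.next S.lib (S.reg t).nVal = (S.reg t).top
  | .popNxt => (S.reg t).top ≠ null
  | .popCas => (S.reg t).top ≠ null ∧ (S.reg t).nTop = LibState.next S.lib (S.reg t).top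
  | .popRet => (S.reg t).top ≠ null
  | _ => True

/-- Calls that own a node not yet on the stack. -/
def CRun.Pushing : CRun R → Prop
  | .pushVal _ => True
  | .pushTop _ => True
  | .pushNxt _ => True
  | .pushCas _ => True
  | _ => False

/-- Calls not yet begun. -/
def CRun.Unstarted (d : CRun R) : Prop := ∃ m, d = CRun.start m

/-- The invariant of the client using the Treiber stack. -/
structure CConf.OK (Ψ : CConf T R X) : Prop where
  prog : ∀ t, (Ψ.prog t).InactiveRun CRun.Unstarted
  mem : Ψ.st.MemOK
  run : ∀ t d, (Ψ.prog t).active = some d → Ψ.st.RunOK t d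
  sep : ∀ t t' d d', t ≠ t' → (Ψ.prog t).active = some d → (Ψ.prog t').active = some d' →
    d.Pushing → d'.Pushing → Sep (Ψ.st.reg t).nVal (Ψ.st.reg t').nVal

variable {t t' : T} {S S' : CState T R X} {a : ℕ}

/-! ### Frame rules and consequences of the memory invariant -/

namespace CState

theorem RunOK.owns {d : CRun R} (h : S.RunOK t d) (hd : d.Pushing) : S.Owns t := by
  cases d with
  | pushVal e => exact h
  | pushTop e => exact h.1
  | pushNxt e => exact h.1
  | pushCas e => exact h.1
  | _ => exact hd.elim

theorem runOK_of_unstarted {d : CRun R} (h : d.Unstarted) : S.RunOK t d := by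
  obtain ⟨m, rfl⟩ := h
  cases m <;> trivial

theorem not_pushing_of_unstarted {d : CRun R} (h : d.Unstarted) : ¬ d.Pushing := by
  obtain ⟨m, rfl⟩ := h
  cases m <;> exact id

/-- Frame rule for the invariant of a method call. -/
theorem RunOK.frame {d : CRun R} (h : S.RunOK t d) (hregs : S'.regs t = S.regs t)
    (hreg : S'.reg t = S.reg t) (hle : (S.lib.tview t).Le (S'.lib.tview t))
    (hused : S.usedAddr ⊆ S'.usedAddr)
    (hpush : d.Pushing → Same S.lib S'.lib (.cell (S.reg t).nVal) ∧
      Same S.lib S'.lib (.cell ((S.reg t).nVal + 1)) ∧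
      ∀ w a, LibState.TopWrite S'.lib w a → w ∉ S.lib.ops → Sep (S.reg t).nVal a)
    (hpop : (S.reg t).top ≠ null → Same S.lib S'.lib (.cell ((S.reg t).top + 1))) :
    S'.RunOK t d := by
  have owns : d.Pushing → S'.Owns t := fun hd => by
    obtain ⟨h₁, h₂, h₃, h₄, h₅, h₆⟩ := h.owns hd
    obtain ⟨s₁, s₂, hw⟩ := hpush hd
    refine ⟨hreg ▸ h₁, hreg ▸ h₂, hreg ▸ hused h₃, hreg ▸ hused h₄, ?_, fun w a hwa => ?_⟩
    · rw [hreg]; exact (h₅.of_same s₁ s₂).mono hle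
    · rw [hreg]
      by_cases hm : w ∈ S.lib.ops
      · exact h₆ w a ⟨hm, hwa.2⟩
      · exact hw w a hwa hm
  cases d with
  | pushVal e => exact owns trivial
  | pushTop e =>
    refine ⟨owns trivial, ?_⟩
    rw [hreg, hregs, (hpush trivial).1.lastVal_eq]; exact h.2
  | pushNxt e =>
    refine ⟨owns trivial, ?_⟩
    rw [hreg, hregs, (hpush trivial).1.lastVal_eq]; exact h.2
  | pushCas e =>
    refine ⟨owns trivial, ?_, ?_⟩
    · rw [hreg, hregs, (hpush trivial).1.lastVal_eq]; exact h.2.1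
    · rw [hreg, LibState.next, (hpush trivial).2.1.lastVal_eq]; exact h.2.2
  | popNxt => exact (congrArg TReg.top hreg).trans_ne h
  | popCas =>
    refine ⟨(congrArg TReg.top hreg).trans_ne h.1, ?_⟩
    rw [hreg, LibState.next, (hpop h.1).lastVal_eq]; exact h.2
  | popRet => exact (congrArg TReg.top hreg).trans_ne h
  | _ => trivial

namespace Evolves
variable (E : S.Evolves t S')
include E

theorem topWrite {w : Act LLoc ℕ × ℚ} (h : LibState.TopWrite S.lib w a) :
    LibState.TopWrite S'.lib w a := ⟨E.ops h.1, h.2⟩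

theorem saw {V : View LLoc (Act LLoc ℕ)} {V' : View X (Act X Val)}
    (h : LibState.Saw S.lib V V' a) : LibState.Saw S'.lib V V' a := by
  obtain ⟨w, hw, h₁, h₂⟩ := h
  refine ⟨w, E.topWrite hw, ?_, ?_⟩
  · rw [E.mview w hw.1]; exact h₁
  · rw [E.mviewCtx w hw.1]; exact h₂

theorem knows {V : View LLoc (Act LLoc ℕ)} {V' : View X (Act X Val)}
    (h : LibState.Knows S.lib S.usedAddr V V' a) (h₁ : Same S.lib S'.lib (.cell a))
    (h₂ : Same S.lib S'.lib (.cell (a + 1))) :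
    LibState.Knows S'.lib S'.usedAddr V V' a := by
  refine ⟨E.used h.1, E.used h.2.1, h.2.2.1.of_same h₁ h₂, ?_⟩
  rw [LibState.next, h₂.lastVal_eq]
  exact fun hn => E.saw (h.2.2.2 hn)

/-- The invariant of the memory state is kept. -/
theorem memOK (M : S.MemOK)
    (htop : ∀ w ∈ S'.lib.ops, w.1.loc = .Top → w ∉ S'.lib.cvd → S'.lib.Latest .Top (tst w))
    (hnew : ∀ w a, LibState.TopWrite S'.lib w a → w ∉ S.lib.ops → w.1.IsRel ∧
      LibState.Knows S'.lib S'.usedAddr (S'.lib.mview w) (S'.lib.mviewCtx w) a)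
    (hreg : (S'.reg t).top ≠ null →
      LibState.Saw S.lib (S'.lib.tview t) (S'.cl.tview t) (S'.reg t).top)
    (hchain : ∃ l, IsStack (LibState.next S'.lib) (S'.lib.lastVal .Top) l ∧
      ∀ a, a ∈ S'.pushedAddr ↔ a ∈ l)
    (hpushed : ∀ a ∈ S'.pushedAddr, ∃ w, LibState.TopWrite S'.lib w a) : S'.MemOK where
  uniq := E.uniq
  top_last := htop
  top_write w a hw := by
    by_cases hm : w ∈ S.lib.ops
    · have hw' : LibState.TopWrite S.lib w a := ⟨hm, hw.2⟩
      rw [E.mview w hm, E.mviewCtx w hm]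
      exact ⟨(M.top_write w a hw').1,
        E.knows (M.top_write w a hw').2 (E.node w a hw').1 (E.node w a hw').2⟩
    · exact hnew w a hw hm
  reg_top t' h := by
    by_cases ht : t' = t
    · subst ht; exact E.saw (hreg h)
    · rw [E.reg t' ht] at h ⊢
      exact (E.saw (M.reg_top t' h)).mono (E.lib_le t') (E.cl_le t')
  unalloc a ha t' :=
    -- A cell unallocated after the step was unallocated before it and has not been written.
    (E.unalloc a ha).latest ((M.unalloc a (fun h => ha (E.used h)) t').mono (E.lib_le t' _))
  chain := hchain
  pushed := hpushed

theorem next_pushed (M : S.MemOK) (ha : a ∈ S.pushedAddr) :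
    LibState.next S'.lib a = LibState.next S.lib a := by
  obtain ⟨w, hw⟩ := M.pushed a ha
  exact (E.node w a hw).2.lastVal_eq

end Evolves

theorem MemOK.top_pushed (M : S.MemOK) (h : S.lib.lastVal .Top ≠ null) :
    S.lib.lastVal .Top ∈ S.pushedAddr := by
  obtain ⟨l, hl, hm⟩ := M.chain
  exact (hm _).2 (hl.mem h)

theorem MemOK.pushed_eq_empty (M : S.MemOK) (h : S.lib.lastVal .Top = null) :
    S.pushedAddr = ∅ := by
  obtain ⟨l, hl, hm⟩ := M.chain
  rw [h] at hl
  rw [hl.eq_nil] at hm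
  exact Set.eq_empty_of_forall_notMem fun a ha => by simpa using (hm a).1 ha

theorem MemOK.next_pushed (M : S.MemOK) (ha : a ∈ S.pushedAddr)
    (h : LibState.next S.lib a ≠ null) : LibState.next S.lib a ∈ S.pushedAddr := by
  obtain ⟨l, hl, hm⟩ := M.chain
  exact (hm _).2 (hl.next_mem ((hm a).1 ha) h)

theorem MemOK.ne_null (M : S.MemOK) (ha : a ∈ S.pushedAddr) : a ≠ null := by
  obtain ⟨w, hw⟩ := M.pushed a ha
  exact hw.2.2.2

/-- What the recorded view of a write to `Top` contains is contained in every view that includes it.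
This turns an acquiring read of `Top` into knowledge of the cells of the node. -/
theorem MemOK.knows (M : S.MemOK) {V : View LLoc (Act LLoc ℕ)} {V' : View X (Act X Val)}
    (h : LibState.Saw S.lib V V' a) : LibState.Knows S.lib S.usedAddr V V' a := by
  obtain ⟨w, hw, h₁, h₂⟩ := h
  exact (M.top_write w a hw).2.mono h₁ h₂

/-- Every write of a non-null address to `Top` is releasing, so an acquiring read of such a value
always synchronises. Only the value null can come from the initial, relaxed write. -/
theorem MemOK.saw_of_read (M : S.MemOK) {w : Act LLoc ℕ × ℚ} (hw : w ∈ S.lib.Obs t .Top)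
    (ha : w.1.wrval = some a) {V : View LLoc (Act LLoc ℕ)} {V' : View X (Act X Val)}
    (h : w.1.IsRel → (S.lib.mview w).Le V ∧ (S.lib.mviewCtx w).Le V') (hn : a ≠ null) :
    LibState.Saw S.lib V V' a := by
  have hw' : LibState.TopWrite S.lib w a := ⟨hw.1, hw.2.1, ha, hn⟩
  exact ⟨w, hw', h (M.top_write w a hw').1⟩

/-- The clauses concern `Top`, the cells of nodes that were written to `Top`, and unallocated cells;
a quiet step changes none of these. Only the register `top` of `t` itself needs a check. -/
theorem Quiet.memOK (Q : S.Quiet t S') (M : S.MemOK)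
    (hreg : (S'.reg t).top ≠ null →
      LibState.Saw S.lib (S'.lib.tview t) (S'.cl.tview t) (S'.reg t).top) : S'.MemOK := by
  refine Q.toEvolves.memOK M (fun w hw hx hc => ?_) (fun w a hw hm => ?_) hreg ?_ ?_
  · rw [Q.cvd] at hc
    exact Q.top.latest (M.top_last w ((Q.top w hx).1 hw) hx hc)
  · exact (hm ((Q.top w hw.2.1).1 hw.1)).elim
  · obtain ⟨l, hl, hm⟩ := M.chain
    rw [Q.top.lastVal_eq, Q.pushed]
    exact ⟨l, hl.congr fun b hb => Q.toEvolves.next_pushed M ((hm b).2 hb), hm⟩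
  · rw [Q.pushed]
    intro a ha
    obtain ⟨w, hw⟩ := M.pushed a ha
    exact ⟨w, Q.toEvolves.topWrite hw⟩

end CState

/-! ### Keeping the invariant: library steps in general, and client steps -/

namespace CConf
variable {Ψ : CConf T R X} {d : CRun R} {h : Hole (CRun R)} {c' : Com R X (CRun R)}

theorem OK.runOK (I : Ψ.OK) (hs : HoleStep d h (Ψ.prog t) c') : Ψ.st.RunOK t d :=
  I.run t d (hs.inactiveRun (I.prog t)).1

/-- The invariant after a library step of the thread `t`. -/
theorem OK.step (I : Ψ.OK) (hs : HoleStep d h (Ψ.prog t) c') (E : Ψ.st.Evolves t S')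
    (M : S'.MemOK) (hok : ∀ d', h = .run d' → S'.RunOK t d')
    (hfr : ∀ t' d', t' ≠ t → (Ψ.prog t').active = some d' → S'.RunOK t' d')
    (hsep : ∀ d₁ t' d', h = .run d₁ → d₁.Pushing → t' ≠ t → (Ψ.prog t').active = some d' →
      d'.Pushing → Sep (S'.reg t).nVal (Ψ.st.reg t').nVal) :
    CConf.OK ⟨fupd Ψ.prog t c', S'⟩ := by
  obtain ⟨-, h₂, h₃⟩ := hs.inactiveRun (I.prog t)
  have hact : ∀ d', c'.active = some d' → h = .run d' := fun d' hd => by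
    rw [h₂] at hd
    cases h with
    | run d => rw [Option.some.inj hd]
    | val v => cases hd
  refine ⟨fun t' => ?_, M, fun t' d' hd => ?_, fun t₁ t₂ d₁ d₂ ht hd₁ hd₂ hp₁ hp₂ => ?_⟩
  · by_cases ht : t' = t
    · subst ht; simpa only [fupd_same] using h₃
    · simpa only [fupd_ne _ _ ht] using I.prog t'
  · by_cases ht : t' = t
    · subst ht
      simp only [fupd_same] at hd
      exact hok d' (hact d' hd)
    · simp only [fupd_ne _ _ ht] at hd
      exact hfr t' d' ht hd
  · dsimp only at hd₁ hd₂ ⊢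
    by_cases h₁ : t₁ = t
    · subst h₁
      rw [fupd_same] at hd₁
      rw [fupd_ne _ _ ht.symm] at hd₂
      rw [E.reg _ ht.symm]
      exact hsep _ _ _ (hact _ hd₁) hp₁ ht.symm hd₂ hp₂
    · rw [fupd_ne _ _ h₁] at hd₁
      rw [E.reg _ h₁]
      by_cases h₂ : t₂ = t
      · subst h₂
        rw [fupd_same] at hd₂
        exact (hsep _ _ _ (hact _ hd₂) hp₂ ht hd₁ hp₁).symm
      · rw [fupd_ne _ _ h₂] at hd₂
        rw [E.reg _ h₂]
        exact I.sep _ _ _ _ ht hd₁ hd₂ hp₁ hp₂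

/-- The invariant is kept by the steps of the client program. -/
theorem OK.cliStep {Ψ' : CConf T R X} (I : Ψ.OK) (hs : CCliStep Ψ Ψ') : Ψ'.OK := by
  -- A client step changes the library component only by enlarging views, so silent steps and memory
  -- accesses share one argument.
  have key : ∀ (t : T) (c' : Com R X (CRun R)) (ρ ρ' : Regs R) (a : Option (Act X Val))
      (S' : CState T R X), CliStep (Ψ.prog t) ρ a c' ρ' →
      (∀ t', t' ≠ t → S'.regs t' = Ψ.st.regs t') → S'.reg = Ψ.st.reg →
      S'.usedAddr = Ψ.st.usedAddr → S'.pushedAddr = Ψ.st.pushedAddr →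
      S'.lib.ops = Ψ.st.lib.ops → S'.lib.mview = Ψ.st.lib.mview →
      S'.lib.mviewCtx = Ψ.st.lib.mviewCtx → S'.lib.cvd = Ψ.st.lib.cvd →
      (∀ t', (Ψ.st.lib.tview t').Le (S'.lib.tview t')) →
      (∀ t', (Ψ.st.cl.tview t').Le (S'.cl.tview t')) →
      CConf.OK ⟨fupd Ψ.prog t c', S'⟩ := by
    intro t c' ρ ρ' a S' hs hregs hreg hused hpushed hops hmv hmc hcvd hle hcl
    obtain ⟨h₁, h₂, h₃⟩ := hs.inactiveRun (I.prog t)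
    have same : ∀ x, Same Ψ.st.lib S'.lib x := fun x => .of_ops hops
    have hact : ∀ t' d', (fupd Ψ.prog t c' t').active = some d' →
        d'.Unstarted ∨ t' ≠ t ∧ (Ψ.prog t').active = some d' := fun t' d' hd => by
      by_cases ht : t' = t
      · subst ht; rw [fupd_same] at hd; exact .inl (h₃ d' hd)
      · rw [fupd_ne _ _ ht] at hd; exact .inr ⟨ht, hd⟩
    have M := I.mem
    have saw : ∀ V V' a, LibState.Saw Ψ.st.lib V V' a → LibState.Saw S'.lib V V' a := by
      rintro V V' a ⟨w, hw, hl⟩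
      refine ⟨w, ⟨hops ▸ hw.1, hw.2⟩, ?_⟩
      rw [hmv, hmc]; exact hl
    have next : ∀ b, LibState.next S'.lib b = LibState.next Ψ.st.lib b :=
      fun b => (same _).lastVal_eq
    refine ⟨fun t' => ?_, ⟨?_, ?_, ?_, ?_, ?_, ?_, ?_⟩, ?_, ?_⟩
    · by_cases ht : t' = t
      · subst ht; simpa only [fupd_same] using h₂
      · simpa only [fupd_ne _ _ ht] using I.prog t'
    · dsimp only [Uniq]; rw [hops]; exact M.uniq
    · intro w hw hx hc
      rw [hops] at hw
      rw [hcvd] at hc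
      exact (same _).latest (M.top_last w hw hx hc)
    · intro w a hw
      obtain ⟨hr, k₁, k₂, k₃, k₄⟩ := M.top_write w a ⟨hops ▸ hw.1, hw.2⟩
      dsimp only
      rw [hused, hmv, hmc]
      refine ⟨hr, k₁, k₂, k₃.of_same (same _) (same _), ?_⟩
      rw [next]
      exact fun hn => saw _ _ _ (k₄ hn)
    · intro t' ht
      dsimp only at ht ⊢
      rw [hreg] at ht ⊢
      exact (saw _ _ _ (M.reg_top t' ht)).mono (hle t') (hcl t')
    · intro a ha t'
      dsimp only at ha
      rw [hused] at ha
      exact (same _).latest ((M.unalloc a ha t').mono (hle t' _))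
    · obtain ⟨l, hl, hm⟩ := M.chain
      refine ⟨l, ?_, ?_⟩
      · dsimp only
        rw [(same _).lastVal_eq]
        exact hl.congr fun b _ => next b
      · dsimp only; rw [hpushed]; exact hm
    · intro a ha
      dsimp only at ha
      rw [hpushed] at ha
      obtain ⟨w, hw⟩ := M.pushed a ha
      exact ⟨w, hops ▸ hw.1, hw.2⟩
    · intro t' d' hd
      rcases hact t' d' hd with hu | ⟨ht, hd⟩
      · exact CState.runOK_of_unstarted hu
      · exact (I.run t' d' hd).frame (hregs t' ht) (congrFun hreg t') (hle t') hused.ge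
          (fun _ => ⟨same _, same _, fun w a hw hm => (hm (hops ▸ hw.1)).elim⟩) fun _ => same _
    · intro t₁ t₂ d₁ d₂ ht hd₁ hd₂ hp₁ hp₂
      rcases hact t₁ d₁ hd₁ with hu | ⟨-, hd₁⟩
      · exact (CState.not_pushing_of_unstarted hu hp₁).elim
      rcases hact t₂ d₂ hd₂ with hu | ⟨-, hd₂⟩
      · exact (CState.not_pushing_of_unstarted hu hp₂).elim
      dsimp only
      rw [hreg]
      exact I.sep _ _ _ _ ht hd₁ hd₂ hp₁ hp₂
  cases hs with
  | eps t c' ρ' hs =>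
    exact key t c' _ _ _ _ hs (fun t' ht => fupd_ne _ _ ht) rfl rfl rfl rfl rfl rfl rfl
      (fun _ => View.Le.refl _) fun _ => View.Le.refl _
  | act t c' ρ' a γ' v' hs hm =>
    exact key t c' _ _ _ _ hs (fun t' ht => fupd_ne _ _ ht) rfl rfl rfl rfl rfl rfl rfl
      (le_fupd_views hm.views_le.2) hm.views_le.1

end CConf

end Invariants

/-! ## Steps of the Treiber stack -/

/-- On `x` the new operation is itself the last one; on other locations neither the operations nor
the view change. Thus a thread writing to one cell of its node still knows both cells. -/
theorem CompState.latest_extend_fupd {T L L' A' V : Type*} {γ : CompState T L (Act L V) L' A'}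
    {x y : L} {t : T} {e : Act L V × ℚ} {q : ℚ} {U tv : View L (Act L V)}
    {cvd : Set (Act L V × ℚ)} {v : View L' A'} (hf : γ.Fresh q (tst e)) (he : e.1.loc = x)
    (hx : γ.Latest x q) (hy : γ.Latest y (tst (U y))) :
    (γ.extend t e tv cvd v).Latest y (tst (fupd U x e y)) := by
  by_cases h : y = x
  · subst h
    rw [fupd_same]
    exact latest_extend hf hx
  · rw [fupd_ne _ _ h]
    exact (same_extend fun h' => h (h'.symm.trans he)).latest hy

theorem Sep.cells {a b c : ℕ} (h : Sep a b) (hc : c = a ∨ c = a + 1) : c ≠ b ∧ c ≠ b + 1 := by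
  obtain ⟨h₁, h₂, h₃⟩ := h
  omega

section LibSteps
variable {T R X : Type*}

/-- The state after a library step of the thread `t`. -/
def CState.after (S : CState T R X) (t : T) (s : TLocal) (v : View X (Act X Val))
    (β : LibState T X) : CState T R X :=
  { S.setTLocal t s with cl := S.cl.setView t v, lib := β }

/-- Silent steps are treated as reads that leave all views unchanged, so that `CConf.OK.readStep`
covers both. -/
theorem CState.setTLocal_eq_after (S : CState T R X) (t : T) (s : TLocal) :
    S.setTLocal t s = S.after t s (S.cl.tview t) (S.lib.setView t (S.lib.tview t)) := by
  simp only [after, setView, setTLocal, fupd_self]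

/-- The possible effects of a library step. -/
inductive LibEvent (Ψ Ψ' : CConf T R X) : Prop
  | quiet (t : T) (d d' : CRun R) (c' : Com R X (CRun R)) :
      HoleStep d (.run d') (Ψ.prog t) c' → Ψ'.prog = fupd Ψ.prog t c' →
      Ψ.st.Quiet t Ψ'.st → Ψ'.st.rval = Ψ.st.rval →
      (∀ d₀, RunCorr Ψ.st t d₀ d → RunCorr Ψ'.st t d₀ d') → LibEvent Ψ Ψ'
  | ret (t : T) (c' : Com R X (CRun R)) (v : ℕ) :
      HoleStep .popRet (.val (some (.num v))) (Ψ.prog t) c' → Ψ'.prog = fupd Ψ.prog t c' →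
      Ψ.st.Quiet t Ψ'.st → Ψ'.st.rval = fupd Ψ.st.rval t (some (.num v)) →
      Ψ.st.lib.lastVal (.cell (Ψ.st.reg t).top) = v → LibEvent Ψ Ψ'
  | push (t : T) (e : Regs R → ℕ) (c' : Com R X (CRun R)) :
      HoleStep (.pushCas e) (.val none) (Ψ.prog t) c' → Ψ'.prog = fupd Ψ.prog t c' →
      Ψ.st.Cas t (Ψ.st.reg t).nVal Ψ'.st → Ψ'.st.rval = fupd Ψ.st.rval t none →
      Ψ'.st.pushedAddr = Ψ.st.pushedAddr ∪ {(Ψ.st.reg t).nVal} → LibEvent Ψ Ψ'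
  | pop (t : T) (c' : Com R X (CRun R)) :
      HoleStep .popCas (.run .popRet) (Ψ.prog t) c' → Ψ'.prog = fupd Ψ.prog t c' →
      Ψ.st.Cas t (Ψ.st.reg t).nTop Ψ'.st → Ψ'.st.rval = Ψ.st.rval →
      Ψ'.st.pushedAddr = Ψ.st.pushedAddr \ {(Ψ.st.reg t).top} → LibEvent Ψ Ψ'

variable {t : T} {Ψ : CConf T R X} {d : CRun R} {h : Hole (CRun R)} {c' : Com R X (CRun R)}
  {s : TLocal} {v' : View X (Act X Val)} {β' : LibState T X}

theorem CState.Owns.of_ops {S S' : CState T R X} (h : S.Owns t)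
    (hv : (S'.reg t).nVal = (S.reg t).nVal) (hn : (S'.reg t).nNxt = (S.reg t).nNxt)
    (hops : S'.lib.ops = S.lib.ops) (hle : (S.lib.tview t).Le (S'.lib.tview t))
    (hused : S.usedAddr ⊆ S'.usedAddr) : S'.Owns t := by
  obtain ⟨h₁, h₂, h₃, h₄, h₅, h₆⟩ := h
  unfold CState.Owns
  rw [hv, hn]
  refine ⟨h₁, h₂, hused h₃, hused h₄, ?_, fun w a hw => h₆ w a ⟨hops ▸ hw.1, hw.2⟩⟩
  exact (h₅.of_same (.of_ops hops) (.of_ops hops)).mono hle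

/-- The invariant after a library step that reads or performs no memory action. -/
theorem CConf.OK.readStep (I : Ψ.OK) (hs : HoleStep d h (Ψ.prog t) c')
    {tv : View LLoc (Act LLoc ℕ)} (htv : (Ψ.st.lib.tview t).Le tv)
    (hv : (Ψ.st.cl.tview t).Le v') (hp : s.pushedAddr = Ψ.st.pushedAddr)
    (hu : Ψ.st.usedAddr ⊆ s.usedAddr)
    (hreg : s.reg.top ≠ null → LibState.Saw Ψ.st.lib tv v' s.reg.top)
    (hok : ∀ d', h = .run d' → (Ψ.st.after t s v' (Ψ.st.lib.setView t tv)).RunOK t d')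
    (hsep : ∀ d', h = .run d' → d'.Pushing → d.Pushing ∧ s.reg.nVal = (Ψ.st.reg t).nVal ∨
      s.reg.nVal ∉ Ψ.st.usedAddr ∧ s.reg.nVal + 1 ∉ Ψ.st.usedAddr) :
    CConf.OK ⟨fupd Ψ.prog t c', Ψ.st.after t s v' (Ψ.st.lib.setView t tv)⟩ ∧
      Ψ.st.Quiet t (Ψ.st.after t s v' (Ψ.st.lib.setView t tv)) := by
  have same : ∀ x, Same Ψ.st.lib (Ψ.st.after t s v' (Ψ.st.lib.setView t tv)).lib x :=
    fun x => .of_ops rfl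
  have Q : Ψ.st.Quiet t (Ψ.st.after t s v' (Ψ.st.lib.setView t tv)) :=
    { regs := rfl
      reg := fun t' ht => fupd_ne _ _ ht
      cl_ops := rfl
      cl_cvd := rfl
      lib_le := le_fupd_views htv
      cl_le := le_fupd_views hv
      ops := subset_rfl
      mview := fun _ _ => rfl
      mviewCtx := fun _ _ => rfl
      used := hu
      node := fun _ _ _ => ⟨same _, same _⟩
      uniq := I.mem.uniq
      unalloc := fun _ _ => same _
      top := same _
      cvd := rfl
      pushed := hp }
  have hregt : (Ψ.st.after t s v' (Ψ.st.lib.setView t tv)).reg t = s.reg := fupd_same _ _ _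
  refine ⟨I.step hs Q.toEvolves (Q.memOK I.mem fun hn => ?_) hok (fun t' d' ht hd => ?_)
    fun d₁ t' d' hd₁ hp₁ ht hd' hp' => ?_, Q⟩
  · rw [hregt] at hn ⊢
    have h₁ : (Ψ.st.after t s v' (Ψ.st.lib.setView t tv)).lib.tview t = tv := fupd_same _ _ _
    have h₂ : (Ψ.st.after t s v' (Ψ.st.lib.setView t tv)).cl.tview t = v' := fupd_same _ _ _
    rw [h₁, h₂]
    exact hreg hn
  · exact (I.run t' d' hd).frame rfl (fupd_ne _ _ ht) (Q.lib_le t') hu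
      (fun _ => ⟨same _, same _, fun w a hw hm => (hm hw.1).elim⟩) fun _ => same _
  · rw [hregt]
    -- Either the thread keeps the node it owned, or it has just allocated one, disjoint from the
    -- used cells of other owners.
    rcases hsep d₁ hd₁ hp₁ with ⟨hp, hn⟩ | ⟨h₁, h₂⟩
    · rw [hn]
      exact I.sep _ _ _ _ ht.symm (hs.inactiveRun (I.prog t)).1 hd' hp hp'
    · obtain ⟨-, -, h₃, h₄, -⟩ := (I.run t' d' hd').owns hp'
      exact sep_of_not_mem h₁ h₂ h₃ h₄

/-- The invariant after a write to a cell of a node that is not yet on the stack. -/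
theorem CConf.OK.writeStep (I : Ψ.OK) {d' : CRun R} (hs : HoleStep d (.run d') (Ψ.prog t) c')
    (hd : d.Pushing) {c n : ℕ} (hc : c = (Ψ.st.reg t).nVal ∨ c = (Ψ.st.reg t).nVal + 1)
    (hm : MemStep t (.wr false (.cell c) n) Ψ.st.lib (Ψ.st.cl.tview t) β' v')
    (hok : (Ψ.st.after t (Ψ.st.tlocal t) v' β').Owns t → β'.lastVal (.cell c) = n →
      (∀ c', c' ≠ c → Same Ψ.st.lib β' (.cell c')) →
      (Ψ.st.after t (Ψ.st.tlocal t) v' β').RunOK t d') :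
    CConf.OK ⟨fupd Ψ.prog t c', Ψ.st.after t (Ψ.st.tlocal t) v' β'⟩ ∧
      Ψ.st.Quiet t (Ψ.st.after t (Ψ.st.tlocal t) v' β') := by
  obtain ⟨rfl, w, hw, q', hf, hβ⟩ := hm.write_inv
  generalize he : ((Act.wr false (LLoc.cell c) n, q') : Act LLoc ℕ × ℚ) = e at hβ
  have het : tst e = q' := by rw [← he]
  have hel : e.1.loc = .cell c := by rw [← he]; rfl
  rw [← het] at hf
  obtain ⟨o₁, o₂, o₃, o₄, o₅, o₆⟩ := (I.runOK hs).owns hd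
  -- The owner's view already contains the last write to the cell, so the new write comes after all
  -- others and fixes its last value.
  have hlat : Ψ.st.lib.Latest (.cell c) (tst w) := by
    refine Latest.mono (q := tst (Ψ.st.lib.tview t (.cell c))) ?_ hw.2.2
    rcases hc with rfl | rfl
    · exact o₅.1
    · exact o₅.2
  have same : ∀ y, y ≠ .cell c → Same Ψ.st.lib β' y := fun y hy => by
    rw [hβ]; exact same_extend fun h => hy (h.symm.trans hel)
  have scell : ∀ c', c ≠ c' → Same Ψ.st.lib β' (.cell c') :=
    fun c' hc => same _ fun h => hc (LLoc.cell.inj h).symm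
  have same_top : Same Ψ.st.lib β' .Top := same _ nofun
  have huniq : β'.Uniq := by rw [hβ]; exact uniq_extend I.mem.uniq hf
  have hnew : ∀ w' a, LibState.TopWrite β' w' a → w' ∈ Ψ.st.lib.ops :=
    fun w' a hw' => (same_top w' hw'.2.1).1 hw'.1
  have hlast : β'.lastVal (.cell c) = n := by
    refine lastVal_eq (w := e) huniq ?_ hel ?_ ?_
    · rw [hβ]; exact .inr rfl
    · rw [hβ]; exact latest_extend hf hlat
    · rw [← he]; rfl
  have Q : Ψ.st.Quiet t (Ψ.st.after t (Ψ.st.tlocal t) (Ψ.st.cl.tview t) β') :=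
    { regs := rfl
      reg := fun t' ht => fupd_ne _ _ ht
      cl_ops := rfl
      cl_cvd := rfl
      lib_le := hm.views_le.1
      cl_le := le_fupd_views (View.Le.refl _)
      ops := fun w' hw' => by
        change w' ∈ β'.ops
        rw [hβ]; exact .inl hw'
      mview := fun w' hw' => by
        change β'.mview w' = _
        rw [hβ]; exact mview_extend (hf.not_mem rfl) hw'
      mviewCtx := fun w' hw' => by
        change β'.mviewCtx w' = _
        rw [hβ]; exact mviewCtx_extend (hf.not_mem rfl) hw'
      used := subset_rfl
      -- The cell belongs to a private node, which is disjoint from every node ever written to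
      -- `Top`.
      node := fun w' a hw' => by
        have := (o₆ w' a hw').cells hc
        exact ⟨scell _ this.1, scell _ this.2⟩
      uniq := huniq
      unalloc := fun a ha => scell _ fun h => ha (by
        rcases hc with hc | hc
        · exact h ▸ hc ▸ o₃
        · exact h ▸ hc ▸ o₄)
      top := same_top
      cvd := by change β'.cvd = _; rw [hβ]; rfl
      pushed := rfl }
  have hregt : ∀ t', (Ψ.st.after t (Ψ.st.tlocal t) (Ψ.st.cl.tview t) β').reg t' = Ψ.st.reg t' :=
    fun t' => congrFun (fupd_self Ψ.st.reg t) t'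
  have owns : (Ψ.st.after t (Ψ.st.tlocal t) (Ψ.st.cl.tview t) β').Owns t := by
    unfold CState.Owns
    rw [hregt]
    refine ⟨o₁, o₂, o₃, o₄, ?_, fun w' a hw' => o₆ w' a ⟨hnew w' a hw', hw'.2⟩⟩
    have htv : β'.tview t = fupd (Ψ.st.lib.tview t) (.cell c) e := by
      rw [hβ]; exact fupd_same _ _ _
    constructor
    · change β'.Latest _ (tst (β'.tview t _))
      rw [htv, hβ]
      exact latest_extend_fupd hf hel hlat o₅.1
    · change β'.Latest _ (tst (β'.tview t _))
      rw [htv, hβ]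
      exact latest_extend_fupd hf hel hlat o₅.2
  refine ⟨I.step hs Q.toEvolves (Q.memOK I.mem fun hn => ?_) (fun d₁ hd₁ => ?_)
    (fun t' d₁ ht hd₁ => ?_) fun d₁ t' d₂ hd₁ hp₁ ht hd₂ hp₂ => ?_, Q⟩
  · rw [hregt] at hn ⊢
    exact (I.mem.reg_top t hn).mono (Q.lib_le t) (Q.cl_le t)
  · cases hd₁
    exact hok owns hlast fun c' hc => scell c' hc.symm
  · refine (I.run t' d₁ hd₁).frame rfl (hregt t') (Q.lib_le t') subset_rfl (fun hp => ?_) fun hn => ?_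
    · have := (I.sep _ _ _ _ ht.symm (hs.inactiveRun (I.prog t)).1 hd₁ hd hp).cells hc
      exact ⟨scell _ this.1, scell _ this.2, fun w' a hw' hm => (hm (hnew w' a hw')).elim⟩
    -- The register `top` of another thread holds an address once written to `Top`, hence not the
    -- private node of `t`.
    · obtain ⟨w', hw', -⟩ := I.mem.reg_top t' hn
      exact scell _ ((o₆ w' _ hw').cells hc).2
  · rw [hregt]
    exact I.sep _ _ _ _ ht.symm (hs.inactiveRun (I.prog t)).1 hd₂ hd hp₂

/-- The invariant after a successful CAS. -/
theorem CConf.OK.casStep (I : Ψ.OK) (hs : HoleStep d h (Ψ.prog t) c') {n : ℕ}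
    (hm : MemStep t (.upd true false .Top (Ψ.st.reg t).top n) Ψ.st.lib (Ψ.st.cl.tview t) β' v')
    (hreg : s.reg = Ψ.st.reg t) (hu : s.usedAddr = Ψ.st.usedAddr)
    (hk : n ≠ null →
      LibState.Knows Ψ.st.lib Ψ.st.usedAddr (Ψ.st.lib.tview t) (Ψ.st.cl.tview t) n)
    (hchain : Ψ.st.lib.lastVal .Top = (Ψ.st.reg t).top →
      ∃ l, IsStack (LibState.next Ψ.st.lib) n l ∧ ∀ a, a ∈ s.pushedAddr ↔ a ∈ l)
    (hpushed : ∀ a ∈ s.pushedAddr, a = n ∧ n ≠ null ∨ a ∈ Ψ.st.pushedAddr)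
    (hok : ∀ d', h = .run d' → d' = .popRet ∧ (Ψ.st.reg t).top ≠ null)
    (hsep : ∀ t' d', t' ≠ t → (Ψ.prog t').active = some d' → d'.Pushing → n ≠ null →
      Sep (Ψ.st.reg t').nVal n) :
    CConf.OK ⟨fupd Ψ.prog t c', Ψ.st.after t s v' β'⟩ ∧
      Ψ.st.Cas t n (Ψ.st.after t s v' β') := by
  obtain ⟨rfl, w, hw, hc, hwm, q', hf, hβ⟩ := hm.updateRel_inv
  generalize he : ((Act.upd true false LLoc.Top (Ψ.st.reg t).top n, q') : Act LLoc ℕ × ℚ) = e at hβ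
  have het : tst e = q' := by rw [← he]
  have hel : e.1.loc = .Top := by rw [← he]; rfl
  have hev : e.1.wrval = some n := by rw [← he]; rfl
  have her : e.1.IsRel := by rw [← he]; rfl
  rw [← het] at hf
  have M := I.mem
  -- The operation read by the CAS is uncovered, hence last on `Top`: the CAS acts on the current
  -- value.
  have hlat : Ψ.st.lib.Latest .Top (tst w) := M.top_last w hw.1 hw.2.1 hc
  have hold : Ψ.st.lib.lastVal .Top = (Ψ.st.reg t).top := lastVal_eq M.uniq hw.1 hw.2.1 hlat hwm
  have same : ∀ c, Same Ψ.st.lib β' (.cell c) := fun c => by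
    rw [hβ]; exact same_extend fun h => nomatch h.symm.trans hel
  have hnext : ∀ b, LibState.next β' b = LibState.next Ψ.st.lib b := fun b => (same _).lastVal_eq
  have huniq : β'.Uniq := by rw [hβ]; exact uniq_extend M.uniq hf
  have hmem : ∀ w', w' ∈ β'.ops ↔ w' ∈ Ψ.st.lib.ops ∨ w' = e := fun w' => by rw [hβ]; rfl
  have hle : β'.Latest .Top (tst e) := by rw [hβ]; exact latest_extend hf hlat
  have hlast : β'.lastVal .Top = n := lastVal_eq huniq ((hmem e).2 (.inr rfl)) hel hle hev
  have hmv : β'.mview e = β'.tview t := by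
    rw [hβ]; exact (fupd_same _ _ _).trans (fupd_same _ _ _).symm
  have hmc : β'.mviewCtx e = Ψ.st.cl.tview t := by rw [hβ]; exact fupd_same _ _ _
  have hregt : ∀ t', (Ψ.st.after t s (Ψ.st.cl.tview t) β').reg t' = Ψ.st.reg t' := fun t' => by
    change fupd _ _ _ _ = _
    rw [hreg, fupd_self]
  have E : Ψ.st.Evolves t (Ψ.st.after t s (Ψ.st.cl.tview t) β') :=
    { regs := rfl
      reg := fun t' _ => hregt t'
      cl_ops := rfl
      cl_cvd := rfl
      lib_le := hm.views_le.1
      cl_le := le_fupd_views (View.Le.refl _)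
      ops := fun w' hw' => (hmem w').2 (.inl hw')
      mview := fun w' hw' => by
        change β'.mview w' = _
        rw [hβ]; exact mview_extend (hf.not_mem rfl) hw'
      mviewCtx := fun w' hw' => by
        change β'.mviewCtx w' = _
        rw [hβ]; exact mviewCtx_extend (hf.not_mem rfl) hw'
      used := hu.ge
      node := fun _ _ _ => ⟨same _, same _⟩
      uniq := huniq
      unalloc := fun _ _ => same _ }
  have C : Ψ.st.Cas t n (Ψ.st.after t s (Ψ.st.cl.tview t) β') :=
    { E with
      reg_eq := funext hregt
      cell := same
      old_top := hold
      new_top := hlast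
      new := fun w' hw' hm' => by
        obtain rfl := ((hmem w').1 hw').resolve_left hm'
        exact ⟨hev, hmc⟩ }
  have hnew : ∀ w' a, LibState.TopWrite β' w' a → w' ∉ Ψ.st.lib.ops → w' = e ∧ a = n :=
    fun w' a hw' hm' => by
      obtain rfl := ((hmem w').1 hw'.1).resolve_left hm'
      exact ⟨rfl, Option.some.inj (hw'.2.2.1.symm.trans hev)⟩
  refine ⟨I.step hs E (E.memOK M ?_ ?_ ?_ ?_ ?_) ?_ ?_ ?_, C⟩
  · intro w' hw' hx hc'
    change w' ∉ β'.cvd at hc'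
    have hc₁ : w' ∉ Ψ.st.lib.cvd ∪ {w} := by rwa [hβ] at hc'
    rcases (hmem w').1 hw' with hw' | rfl
    · have hl := M.top_last w' hw' hx fun h => hc₁ (.inl h)
      refine (hc₁ (.inr ?_)).elim
      exact M.uniq w' hw' w hw.1 (hx.trans hw.2.1.symm)
        (le_antisymm (hlat w' hw' hx) (hl w hw.1 hw.2.1))
    · exact hle
  · intro w' a hw' hm'
    obtain ⟨rfl, rfl⟩ := hnew w' a hw' hm'
    refine ⟨her, E.knows ?_ (same _) (same _)⟩
    change LibState.Knows _ _ (β'.mview w') (β'.mviewCtx w') a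
    rw [hmv, hmc]
    -- The new write records the whole views of `t`, so it passes on all that `t` knows about the
    -- node `n`.
    exact (hk hw'.2.2.2).mono (hm.views_le.1 t) (View.Le.refl _)
  · intro hn
    rw [hregt] at hn ⊢
    exact (M.reg_top t hn).mono (E.lib_le t) (E.cl_le t)
  · obtain ⟨l, hl, hp⟩ := hchain hold
    refine ⟨l, ?_, hp⟩
    change IsStack (LibState.next β') (β'.lastVal .Top) l
    rw [hlast]
    exact hl.congr fun b _ => hnext b
  · intro a ha
    rcases hpushed a ha with ⟨rfl, hn⟩ | ha
    · exact ⟨e, (hmem e).2 (.inr rfl), hel, hev, hn⟩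
    · obtain ⟨w', hw'⟩ := M.pushed a ha
      exact ⟨w', E.topWrite hw'⟩
  · intro d' hd'
    obtain ⟨rfl, hn⟩ := hok d' hd'
    exact (congrArg TReg.top (hregt t)).trans_ne hn
  · intro t' d' ht hd'
    refine (I.run t' d' hd').frame rfl (hregt t') (E.lib_le t') E.used (fun hp => ?_)
      fun _ => same _
    refine ⟨same _, same _, fun w' a hw' hm' => ?_⟩
    obtain ⟨rfl, rfl⟩ := hnew w' a hw' hm'
    exact hsep t' d' ht hd' hp hw'.2.2.2
  · intro d₁ t' d' hd₁ hp₁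
    obtain ⟨rfl, -⟩ := hok d₁ hd₁
    exact hp₁.elim

end LibSteps

section LibStep
variable {T R X : Type*} {t : T} {Ψ Ψ' : CConf T R X}

theorem CState.after_reg (S : CState T R X) (t : T) (s : TLocal) (v : View X (Act X Val))
    (β : LibState T X) : (S.after t s v β).reg t = s.reg := fupd_same _ _ _

theorem CState.after_rval (S : CState T R X) (t : T) (s : TLocal) (v : View X (Act X Val))
    (β : LibState T X) (h : s.rval = S.rval t) : (S.after t s v β).rval = S.rval := by
  change fupd _ _ _ = _
  rw [h, fupd_self]

/-- Library steps keep the invariant and have one of the effects `LibEvent`. -/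
theorem CConf.OK.libStep (I : Ψ.OK) (hs : CLibStep Ψ Ψ') : Ψ'.OK ∧ LibEvent Ψ Ψ' := by
  have M := I.mem
  cases hs with
  | eps t d h c' s' hs hr =>
    rw [CState.setTLocal_eq_after]
    have ok := I.runOK hs
    cases hr with
    | pushNew e _ a ha h₁ h₂ =>
      have key := I.readStep hs (s := ⟨⟨a, a + 1, (Ψ.st.reg t).top, (Ψ.st.reg t).nTop⟩,
        Ψ.st.rval t, Ψ.st.usedAddr ∪ {a, a + 1}, Ψ.st.pushedAddr⟩) (View.Le.refl _)
        (View.Le.refl _) rfl Set.subset_union_left (M.reg_top t) (fun d' hd' => ?_)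
        fun _ _ _ => .inr ⟨h₁, h₂⟩
      · refine ⟨key.1, .quiet t _ _ _ hs rfl key.2 (CState.after_rval _ _ _ _ _ rfl) ?_⟩
        intro d₀ hd₀
        cases hd₀
        exact .pushVal e
      · cases hd'
        change CState.Owns _ t
        unfold CState.Owns
        rw [CState.after_reg]
        refine ⟨ha, rfl, .inr (.inl rfl), .inr (.inr rfl), ⟨?_, ?_⟩, fun w b hw => ?_⟩
        · change Ψ.st.lib.Latest _ (tst (fupd Ψ.st.lib.tview t (Ψ.st.lib.tview t) t _))
          rw [fupd_self]
          exact M.unalloc a h₁ t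
        · change Ψ.st.lib.Latest _ (tst (fupd Ψ.st.lib.tview t (Ψ.st.lib.tview t) t _))
          rw [fupd_self]
          exact M.unalloc (a + 1) h₂ t
        · have := (M.top_write w b hw).2
          exact sep_of_not_mem h₁ h₂ this.1 this.2.1
    | popTestNull _ hn =>
      have key := I.readStep hs (s := Ψ.st.tlocal t) (View.Le.refl _)
        (View.Le.refl _) rfl subset_rfl (M.reg_top t)
        (fun d' hd' => by cases hd'; trivial) fun d' hd' hp => by cases hd'; exact hp.elim
      refine ⟨key.1, .quiet t _ _ _ hs rfl key.2 (CState.after_rval _ _ _ _ _ rfl) ?_⟩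
      intro d₀ hd₀
      cases hd₀
      exact .popTop
    | popTest _ hn =>
      have key := I.readStep hs (s := Ψ.st.tlocal t) (View.Le.refl _)
        (View.Le.refl _) rfl subset_rfl (M.reg_top t)
        (fun d' hd' => by
          cases hd'
          change TReg.top (CState.reg _ t) ≠ null
          rw [CState.after_reg]
          exact hn)
        fun d' hd' hp => by cases hd'; exact hp.elim
      refine ⟨key.1, .quiet t _ _ _ hs rfl key.2 (CState.after_rval _ _ _ _ _ rfl) ?_⟩
      intro d₀ hd₀
      cases hd₀
      exact .popNxt
  | act t d h c' s' a β' v' hs hr hm =>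
    change CConf.OK ⟨_, Ψ.st.after t s' v' β'⟩ ∧ LibEvent Ψ ⟨_, Ψ.st.after t s' v' β'⟩
    have ok := I.runOK hs
    cases hr with
    | pushVal e =>
      have key := I.writeStep hs trivial (.inl rfl) hm fun ho hl _ => ⟨ho, by
        rw [CState.after_reg]; exact hl⟩
      refine ⟨key.1, .quiet t _ _ _ hs rfl key.2 (CState.after_rval _ _ _ _ _ rfl) ?_⟩
      intro d₀ hd₀
      cases hd₀
      exact .pushTop e
    | pushTop e _ v =>
      obtain ⟨w, hw, hwv, tv, rfl, htv, hv, hacq⟩ := hm.read_inv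
      have key := I.readStep hs
        (s := ⟨⟨(Ψ.st.reg t).nVal, (Ψ.st.reg t).nNxt, v, (Ψ.st.reg t).nTop⟩,
          Ψ.st.rval t, Ψ.st.usedAddr, Ψ.st.pushedAddr⟩) htv hv rfl subset_rfl
        (M.saw_of_read hw hwv fun hr => hacq hr rfl)
        (fun d' hd' => by
          cases hd'
          refine ⟨ok.1.of_ops ?_ ?_ rfl (le_fupd_views htv t) subset_rfl, ?_⟩
          · rw [CState.after_reg]
          · rw [CState.after_reg]
          · rw [CState.after_reg]; exact ok.2)
        fun d' hd' hp => .inl ⟨trivial, rfl⟩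
      refine ⟨key.1, .quiet t _ _ _ hs rfl key.2 (CState.after_rval _ _ _ _ _ rfl) ?_⟩
      intro d₀ hd₀
      cases hd₀
      exact .pushNxt e
    | pushNxt e =>
      have hn : (Ψ.st.tlocal t).reg.nNxt = (Ψ.st.reg t).nVal + 1 := ok.1.2.1
      rw [hn] at hm
      have key := I.writeStep hs trivial (.inr rfl) hm fun ho hl hsame => by
        refine ⟨ho, ?_, ?_⟩
        · rw [CState.after_reg]
          exact (hsame _ (Nat.lt_succ_self _).ne).lastVal_eq.trans ok.2
        · rw [CState.after_reg]; exact hl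
      refine ⟨key.1, .quiet t _ _ _ hs rfl key.2 (CState.after_rval _ _ _ _ _ rfl) ?_⟩
      intro d₀ hd₀
      cases hd₀
      exact .pushCas e
    | pushCasFail e _ v hv' =>
      obtain ⟨w, hw, hwv, tv, rfl, htv, hv, -⟩ := hm.read_inv
      have key := I.readStep hs (s := Ψ.st.tlocal t) htv hv rfl subset_rfl
        (fun hn => (M.reg_top t hn).mono htv hv)
        (fun d' hd' => by
          cases hd'
          refine ⟨ok.1.of_ops ?_ ?_ rfl (le_fupd_views htv t) subset_rfl, ?_⟩
          · rw [CState.after_reg]; rfl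
          · rw [CState.after_reg]; rfl
          · rw [CState.after_reg]; exact ok.2.1)
        fun d' hd' hp => .inl ⟨trivial, rfl⟩
      refine ⟨key.1, .quiet t _ _ _ hs rfl key.2 (CState.after_rval _ _ _ _ _ rfl) ?_⟩
      intro d₀ hd₀
      cases hd₀
      exact .pushTop e
    | pushCasSucc e =>
      obtain ⟨⟨o₁, o₂, o₃, o₄, o₅, o₆⟩, ok₂, ok₃⟩ := ok
      have key := I.casStep hs (n := (Ψ.st.reg t).nVal) (s := ⟨Ψ.st.reg t, none, Ψ.st.usedAddr,
        Ψ.st.pushedAddr ∪ {(Ψ.st.reg t).nVal}⟩) hm rfl rfl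
        -- The next node is the expected value `top`, which `t` saw by its acquiring read.
        (fun _ => ⟨o₃, o₄, o₅, by rw [ok₃]; exact M.reg_top t⟩)
        (fun htop => by
          obtain ⟨l, hl, hp⟩ := M.chain
          rw [htop, ← ok₃] at hl
          refine ⟨_, .cons _ l o₁ (fun hmem => ?_) hl, fun a => ?_⟩
          -- A pushed address was once written to `Top`, whereas an owned node never was; so the
          -- list stays free of repetitions.
          · obtain ⟨w, hw⟩ := M.pushed _ ((hp _).2 hmem)
            exact (o₆ w _ hw).1 rfl
          · rw [List.mem_cons, ← hp a, Set.mem_union, Set.mem_singleton_iff, or_comm])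
        (fun a ha => ha.elim .inr fun ha => .inl ⟨ha, o₁⟩)
        (fun d' hd' => nomatch hd')
        fun t' d' ht hd' hp _ =>
          I.sep _ _ _ _ ht hd' (hs.inactiveRun (I.prog t)).1 hp trivial
      exact ⟨key.1, .push t e _ hs rfl key.2 rfl rfl⟩
    | popTop _ v =>
      obtain ⟨w, hw, hwv, tv, rfl, htv, hv, hacq⟩ := hm.read_inv
      have key := I.readStep hs
        (s := ⟨⟨(Ψ.st.reg t).nVal, (Ψ.st.reg t).nNxt, v, (Ψ.st.reg t).nTop⟩,
          Ψ.st.rval t, Ψ.st.usedAddr, Ψ.st.pushedAddr⟩) htv hv rfl subset_rfl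
        (M.saw_of_read hw hwv fun hr => hacq hr rfl)
        (fun d' hd' => by cases hd'; trivial) fun d' hd' hp => by cases hd'; exact hp.elim
      refine ⟨key.1, .quiet t _ _ _ hs rfl key.2 (CState.after_rval _ _ _ _ _ rfl) ?_⟩
      intro d₀ hd₀
      cases hd₀
      exact .popTest
    | popNxt _ v =>
      obtain ⟨w, hw, hwv, tv, rfl, htv, hv, -⟩ := hm.read_inv
      -- Although relaxed, the read must return the last value: the earlier acquiring read of `Top`
      -- has put the last write to this cell into the view of `t`. The node itself may have been
      -- popped meanwhile.
      have hlast : Ψ.st.lib.lastVal (.cell ((Ψ.st.reg t).top + 1)) = v :=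
        lastVal_eq M.uniq hw.1 hw.2.1 ((M.knows (M.reg_top t ok)).2.2.1.2.mono hw.2.2) hwv
      have key := I.readStep hs
        (s := ⟨⟨(Ψ.st.reg t).nVal, (Ψ.st.reg t).nNxt, (Ψ.st.reg t).top, v⟩,
          Ψ.st.rval t, Ψ.st.usedAddr, Ψ.st.pushedAddr⟩) htv hv rfl subset_rfl
        (fun hn => (M.reg_top t hn).mono htv hv)
        (fun d' hd' => by
          cases hd'
          change TReg.top (CState.reg _ t) ≠ null ∧ TReg.nTop (CState.reg _ t) = _
          rw [CState.after_reg]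
          exact ⟨ok, hlast.symm⟩)
        fun d' hd' hp => by cases hd'; exact hp.elim
      refine ⟨key.1, .quiet t _ _ _ hs rfl key.2 (CState.after_rval _ _ _ _ _ rfl) ?_⟩
      intro d₀ hd₀
      cases hd₀
      exact .popCas
    | popCasFail _ v hv' =>
      obtain ⟨w, hw, hwv, tv, rfl, htv, hv, -⟩ := hm.read_inv
      have key := I.readStep hs (s := Ψ.st.tlocal t) htv hv rfl subset_rfl
        (fun hn => (M.reg_top t hn).mono htv hv)
        (fun d' hd' => by cases hd'; trivial) fun d' hd' hp => by cases hd'; exact hp.elim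
      refine ⟨key.1, .quiet t _ _ _ hs rfl key.2 (CState.after_rval _ _ _ _ _ rfl) ?_⟩
      intro d₀ hd₀
      cases hd₀
      exact .popTop
    | popCasSucc =>
      obtain ⟨ok₁, ok₂⟩ := ok
      -- The CAS acquires nothing, but having seen a write of `top` includes having seen one of its
      -- next node.
      have hsaw : (Ψ.st.reg t).nTop ≠ null →
          LibState.Saw Ψ.st.lib (Ψ.st.lib.tview t) (Ψ.st.cl.tview t) (Ψ.st.reg t).nTop := by
        rw [ok₂]
        exact (M.knows (M.reg_top t ok₁)).2.2.2
      have key := I.casStep hs (n := (Ψ.st.reg t).nTop) (s := ⟨Ψ.st.reg t, Ψ.st.rval t, Ψ.st.usedAddr,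
        Ψ.st.pushedAddr \ {(Ψ.st.reg t).top}⟩) hm rfl rfl
        (fun hn => M.knows (hsaw hn))
        (fun htop => by
          obtain ⟨l, hl, hp⟩ := M.chain
          rw [htop] at hl
          rw [ok₂]
          dsimp only
          generalize (Ψ.st.reg t).top = b at hl ok₁ ⊢
          cases hl with
          | nil => exact (ok₁ rfl).elim
          | cons _ l h₁ h₂ h₃ =>
            refine ⟨l, h₃, fun a => ?_⟩
            rw [Set.mem_sdiff, hp, List.mem_cons, Set.mem_singleton_iff]
            constructor
            · rintro ⟨h | h, h'⟩
              · exact (h' h).elim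
              · exact h
            · exact fun h => ⟨.inr h, fun h' => h₂ (h' ▸ h)⟩)
        (fun a ha => .inr ha.1)
        (fun d' hd' => by cases hd'; exact ⟨rfl, ok₁⟩)
        fun t' d' ht hd' hp hn => by
          obtain ⟨w, hw, -⟩ := hsaw hn
          exact ((I.run t' d' hd').owns hp).2.2.2.2.2 w _ hw
      exact ⟨key.1, .pop t _ hs rfl key.2 (CState.after_rval _ _ _ _ _ rfl) rfl⟩
    | popRet _ v =>
      obtain ⟨w, hw, hwv, tv, rfl, htv, hv, -⟩ := hm.read_inv
      -- The node is no longer on the stack, but its cells stay frozen and known to `t`.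
      have hlast : Ψ.st.lib.lastVal (.cell (Ψ.st.reg t).top) = v :=
        lastVal_eq M.uniq hw.1 hw.2.1 ((M.knows (M.reg_top t ok)).2.2.1.1.mono hw.2.2) hwv
      have key := I.readStep hs (s := ⟨Ψ.st.reg t, some (.num v), Ψ.st.usedAddr,
        Ψ.st.pushedAddr⟩) htv hv rfl subset_rfl
        (fun hn => (M.reg_top t hn).mono htv hv)
        (fun d' hd' => nomatch hd') fun d' hd' => nomatch hd'
      exact ⟨key.1, .ret t _ v hs rfl key.2 rfl hlast⟩

theorem CConf.OK.init (C : Client T R X) (k : X → Val) (l : T → Regs R) :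
    (CConf.init C k l).OK := by
  have hall : ∀ t, ((CConf.init C k l).prog t).AllRun CRun.Unstarted :=
    fun t => Com.allRun_map (fun m => ⟨m, rfl⟩) (C t)
  have huniq : (CConf.init C k l).st.lib.Uniq := by
    rintro _ ⟨x, rfl⟩ _ ⟨y, rfl⟩ hxy -
    have : x = y := hxy
    rw [this]
  have hlatest : ∀ x, (CConf.init C k l).st.lib.Latest x 0 := by
    rintro x _ ⟨y, rfl⟩ -
    exact le_rfl
  -- Every library location, `Top` included, starts with `0`, which is null, so the clauses about
  -- writes of nodes are vacuous.
  have hno : ∀ w a, ¬ LibState.TopWrite (CConf.init C k l).st.lib w a := by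
    rintro _ a ⟨⟨y, rfl⟩, -, ha, hn⟩
    exact hn (Option.some.inj ha).symm
  have htop : (CConf.init C k l).st.lib.lastVal .Top = null :=
    lastVal_eq huniq ⟨.Top, rfl⟩ rfl (hlatest _) rfl
  refine ⟨fun t => (hall t).inactiveRun.1, ⟨huniq, ?_, ?_, ?_, ?_, ?_, ?_⟩, ?_, ?_⟩
  · rintro _ ⟨y, rfl⟩ - -
    exact hlatest _
  · exact fun w a hw => (hno w a hw).elim
  · exact fun t ht => (ht rfl).elim
  · exact fun a _ t => hlatest _
  · refine ⟨[], ?_, fun a => ?_⟩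
    · rw [htop]; exact .nil
    · simp [CConf.init]
  · exact fun a ha => ha.elim
  · exact fun t d hd => CState.runOK_of_unstarted ((hall t).inactiveRun.2 d hd)
  · exact fun t t' d d' _ hd _ hp =>
      (CState.not_pushing_of_unstarted ((hall t).inactiveRun.2 d hd) hp).elim

theorem CConf.OK.of_reachable {C : Client T R X} {k : X → Val} {l : T → Regs R}
    (h : Relation.ReflTransGen CStep (CConf.init C k l) Ψ) : Ψ.OK := by
  induction h with
  | refl => exact .init C k l
  | tail _ hs ih =>
    rcases hs with hs | hs
    · exact ih.cliStep hs
    · exact (ih.libStep hs).1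

end LibStep

/-! ## Timestamps of the abstract stack -/

section Abstract
variable {T R X : Type*}

/-- The timestamps of operations and of matched pairs are at most `B`. -/
def StackState.BoundedBy (α : StackState T X) (B : ℚ) : Prop :=
  (∀ o ∈ α.ops, tst o ≤ B) ∧ ∀ p ∈ α.matched, p.1 ≤ B ∧ p.2 ≤ B

theorem StackBase.bounded {α α' : StackState T X} {t : T} {e : StackAct × ℚ} {B : ℚ}
    (h : StackBase t e α α') (hB : α.BoundedBy B) : α'.BoundedBy (max B (tst e)) := by
  obtain ⟨-, -, rfl⟩ := h
  refine ⟨?_, fun p hp => ⟨(hB.2 p hp).1.trans (le_max_left _ _),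
    (hB.2 p hp).2.trans (le_max_left _ _)⟩⟩
  rintro o (ho | rfl)
  · exact (hB.1 o ho).trans (le_max_left _ _)
  · exact le_max_right _ _

theorem PopBase.bounded {α α' : StackState T X} {t : T} {e w : StackAct × ℚ} {B : ℚ}
    (h : PopBase t e w α α') (hB : α.BoundedBy B) : α'.BoundedBy (max B (tst e)) := by
  obtain ⟨α₁, hb, hw, -, -, -, rfl⟩ := h
  refine ⟨(hb.bounded hB).1, ?_⟩
  rintro p (hp | rfl)
  · exact (hb.bounded hB).2 p hp
  · exact ⟨(hB.1 w hw).trans (le_max_left _ _), le_max_right _ _⟩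

theorem StackStep.bounded {α α' : StackState T X} {t : T} {a : StackAct}
    {v v' : View X (Act X Val)} (h : StackStep t a α v α' v') (hB : ∃ B, α.BoundedBy B) :
    ∃ B, α'.BoundedBy B := by
  obtain ⟨B, hB⟩ := hB
  cases h with
  | pushRlx u ts' _ _ _ hb => exact ⟨_, hb.bounded hB⟩
  | pushSync u ts' _ _ _ hb => exact ⟨_, hb.bounded hB⟩
  | popRlx acq rel u ts ts' _ _ _ hb _ => exact ⟨_, hb.bounded hB⟩
  | popSync u ts ts' _ _ _ hb => exact ⟨_, hb.bounded hB⟩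
  | popEmpty acq ts' _ _ _ _ =>
    refine ⟨max B ts', ?_, fun p hp => ⟨(hB.2 p hp).1.trans (le_max_left _ _),
      (hB.2 p hp).2.trans (le_max_left _ _)⟩⟩
    rintro o (ho | rfl)
    · exact (hB.1 o ho).trans (le_max_left _ _)
    · exact le_max_right _ _

/-- The only fact used about reachable abstract configurations: it leaves room for a new operation
after everything else. -/
theorem AStep.bounded_of_reachable {C : Client T R X} {k : X → Val} {l : T → Regs R}
    {Ω : AConf T R X} (h : Relation.ReflTransGen AStep (AConf.init C k l) Ω) :
    ∃ B, Ω.st.lib.BoundedBy B := by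
  induction h with
  | refl => exact ⟨0, by rintro o rfl; exact le_rfl, fun p hp => hp.elim⟩
  | tail _ hs ih =>
    cases hs with
    | cliEps => exact ih
    | cliAct => exact ih
    | libEps => exact ih
    | libAct _ _ _ _ _ _ _ _ _ _ hs => exact hs.bounded ih

end Abstract

/-! ## The simulation -/

section Simulation
variable {T R X : Type*} {t : T} {S S' : CState T R X} {Ω : AConf T R X} {Ψ Ψ' : CConf T R X}

theorem RunCorr.of_unstarted {d₀ : ARun R} {d : CRun R} (hd : d.Unstarted)
    (h : RunCorr S t d₀ d) : RunCorr S' t d₀ d := by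
  obtain ⟨m, rfl⟩ := hd
  cases m with
  | push e => cases h; exact .pushNew e
  | pop => cases h; exact .popTop

/-- Only `popRet` refers to the state, through the value of a node whose address was written to
`Top`; that cell is frozen. -/
theorem RunCorr.evolve {t' : T} {d₀ : ARun R} {d : CRun R} (M : S.MemOK) (E : S.Evolves t S')
    (ht : t' ≠ t) (hok : S.RunOK t' d) (h : RunCorr S t' d₀ d) : RunCorr S' t' d₀ d := by
  cases h with
  | popRet =>
    obtain ⟨w, hw, -⟩ := M.reg_top t' hok
    rw [← (E.node w _ hw).1.lastVal_eq, ← E.reg t' ht]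
    exact .popRet
  | _ => constructor

/-- Corresponding programs after a step of the call of thread `t`. -/
theorem Corr.holeStep (I : Ψ.OK) {d : CRun R} {h : Hole (CRun R)} {c' : Com R X (CRun R)}
    (hs : HoleStep d h (Ψ.prog t) c') (hprog : Ψ'.prog = fupd Ψ.prog t c')
    (E : Ψ.st.Evolves t Ψ'.st) (hc : Corr Ω Ψ) :
    ∃ d₀, RunCorr Ψ.st t d₀ d ∧ ∀ h₀, HoleCorr (RunCorr Ψ'.st t) h₀ h →
      ∃ a', HoleStep d₀ h₀ (Ω.prog t) a' ∧ ∀ st, Corr ⟨fupd Ω.prog t a', st⟩ Ψ' := by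
  obtain ⟨d₀, hd, hh⟩ := (hc t).holeStep (rel' := RunCorr Ψ'.st t) (I.prog t)
    (fun _ _ => RunCorr.of_unstarted) hs
  refine ⟨d₀, hd, fun h₀ hh₀ => ?_⟩
  obtain ⟨a', hs', ha'⟩ := hh h₀ hh₀
  refine ⟨a', hs', fun st t' => ?_⟩
  rw [hprog]
  by_cases ht : t' = t
  · subst ht
    simp only [fupd_same]
    exact ha'
  · simp only [fupd_ne _ _ ht]
    exact (hc t').mono (I.prog t') (fun _ _ => RunCorr.of_unstarted) fun d' d'' hd =>
      RunCorr.evolve I.mem E ht (I.run t' d'' hd)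

/-- `f` maps the nodes on the Treiber stack to the unmatched pushes of the abstract stack. -/
structure StackMap (α : StackState T X) (S : CState T R X) (f : ℕ → StackAct × ℚ) : Prop where
  inj : Set.InjOn f (insert null S.pushedAddr)
  null_eq : ∃ b ts, f null = (.pop b .empty, ts)
  node : ∀ a ∈ S.pushedAddr, f a ∈ α.unmatchedPush ∧
    (f a).1.pushVal = some (S.lib.lastVal (.cell a)) ∧
    tst (f (LibState.next S.lib a)) < tst (f a)
  gap : ∀ a ∈ S.pushedAddr, ∀ op ∈ α.unmatchedPush,
    op ≠ f a → op ≠ f (LibState.next S.lib a) →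
    tst op < tst (f (LibState.next S.lib a)) ∨ tst (f a) < tst op
  top : S.lib.lastVal .Top ≠ null → f (S.lib.lastVal .Top) ∈ α.unmatchedPush ∧
    ∀ op ∈ α.unmatchedPush, tst op ≤ tst (f (S.lib.lastVal .Top))
  seen : ∀ a ∈ S.pushedAddr, ∀ w ∈ S.lib.ops, w.1.loc = .Top → w.1.wrval = some a →
    (α.mviewCtx (f a)).Le (S.lib.mviewCtx w)

/-! ### Maintaining the map from nodes to unmatched pushes -/

namespace StackMap
variable {α α' : StackState T X} {f : ℕ → StackAct × ℚ}

theorem seen_saw (F : StackMap α S f) {V : View LLoc (Act LLoc ℕ)} {V' : View X (Act X Val)}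
    {a : ℕ} (ha : a ∈ S.pushedAddr) (h : LibState.Saw S.lib V V' a) :
    (α.mviewCtx (f a)).Le V' := by
  obtain ⟨w, hw, -, hle⟩ := h
  exact (F.seen a ha w hw.1 hw.2.1 hw.2.2.1).trans hle

/-- The condition of `RTS` on the registers `top` is not part of `StackMap`: a thread holding a
pushed address has seen some write of it to `Top`, and the condition on these writes gives the
bound. -/
theorem rts {A : AState T R X} (F : StackMap A.lib S f) (M : S.MemOK) (hregs : A.regs = S.regs)
    (hrval : A.rval = S.rval) (hops : A.cl.ops = S.cl.ops) (hcvd : A.cl.cvd = S.cl.cvd)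
    (hle : ∀ t, (A.cl.tview t).Le (S.cl.tview t)) : RTS A S := by
  refine ⟨hregs, hrval, hops, hcvd, f, F.inj, F.null_eq, F.node, F.gap, F.top, ?_, F.seen, hle⟩
  rintro t a ha rfl
  exact F.seen_saw ha (M.reg_top t (M.ne_null ha))

/-- An unmatched push with the timestamp of a node is the push of that node. -/
theorem eq_of_tst (F : StackMap α S f) {a : ℕ} {op : StackAct × ℚ} (ha : a ∈ S.pushedAddr)
    (hop : op ∈ α.unmatchedPush) (h : tst op = tst (f a)) : op = f a := by
  by_contra hne
  have h₁ := (F.node a ha).2.2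
  by_cases hn : op = f (LibState.next S.lib a)
  · rw [← hn] at h₁
    exact h₁.ne h
  · rcases F.gap a ha op hop hne hn with h₂ | h₂
    · exact (h₂.trans h₁).ne h
    · exact h₂.ne' h

theorem quiet (F : StackMap α S f) (M : S.MemOK) (Q : S.Quiet t S') : StackMap α S' f := by
  have hnext := fun a ha => Q.toEvolves.next_pushed (a := a) M ha
  refine ⟨?_, F.null_eq, ?_, ?_, ?_, ?_⟩
  · rw [Q.pushed]; exact F.inj
  · rw [Q.pushed]
    intro a ha
    obtain ⟨w, hw⟩ := M.pushed a ha
    rw [hnext a ha, (Q.node w a hw).1.lastVal_eq]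
    exact F.node a ha
  · rw [Q.pushed]
    intro a ha
    rw [hnext a ha]
    exact F.gap a ha
  · rw [Q.top.lastVal_eq]; exact F.top
  · rw [Q.pushed]
    intro a ha w hw hx hv
    have hw' := (Q.top w hx).1 hw
    rw [Q.mviewCtx w hw']
    exact F.seen a ha w hw' hx hv

/-- On an empty stack, `null` may be mapped to any timestamp. -/
theorem exists_null_late (F : StackMap α S f) (M : S.MemOK) {B : ℚ} (hB : α.BoundedBy B) :
    ∃ f, StackMap α S f ∧
      (S.lib.lastVal .Top = null → ∀ op ∈ α.unmatchedPush, tst op < tst (f null)) := by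
  -- With `Top` null no address is pushed, so the other conditions are vacuous. They do not exclude
  -- unmatched pushes in this case, and a node pushed next needs all of these to lie before `f
  -- null`.
  by_cases h : S.lib.lastVal .Top = null
  · have hp := M.pushed_eq_empty h
    refine ⟨fun _ => (.pop false .empty, B + 1), ⟨?_, ⟨_, _, rfl⟩, ?_, ?_, fun h' => (h' h).elim, ?_⟩,
      fun _ op hop => (hB.1 op hop.1).trans_lt (lt_add_one B)⟩
    · rw [hp]; simp
    all_goals rw [hp]; exact fun a ha => ha.elim
  · exact ⟨f, F, fun h' => (h h').elim⟩

/-- The new operation is later than all others, and the next node of `n` is the old top, whose image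
is the last old unmatched push (or `f null`, placed late enough). So nothing unmatched lies in
between. -/
theorem push (F : StackMap α S f) (M : S.MemOK) {n : ℕ} (C : S.Cas t n S') {e : StackAct × ℚ}
    {B : ℚ} {v : View X (Act X Val)} (hn : n ≠ null)
    (hnew : ∀ w, ¬ LibState.TopWrite S.lib w n)
    (hnext : LibState.next S.lib n = S.lib.lastVal .Top)
    (hpushed : S'.pushedAddr = S.pushedAddr ∪ {n}) (hB : α.BoundedBy B)
    (htop : S.lib.lastVal .Top = null → ∀ op ∈ α.unmatchedPush, tst op < tst (f null))
    (he : e.1 = .push true (S.lib.lastVal (.cell n))) (heB : B < tst e)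
    (hen : tst (f null) < tst e) (hv : v.Le (S.cl.tview t))
    (hops : α'.ops = α.ops ∪ {e}) (hmatched : α'.matched = α.matched)
    (hmview : α'.mviewCtx = fupd α.mviewCtx e v) : StackMap α' S' (fupd f n e) := by
  have hnp : ∀ a ∈ S.pushedAddr, a ≠ n := by
    rintro a ha rfl
    obtain ⟨w, hw⟩ := M.pushed a ha
    exact hnew w hw
  have hU : ∀ op, op ∈ α'.unmatchedPush ↔ op ∈ α.unmatchedPush ∨ op = e := by
    intro op
    unfold StackState.unmatchedPush
    rw [hops, hmatched]
    constructor
    · rintro ⟨h₁ | h₁, h₂⟩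
      · exact .inl ⟨h₁, h₂⟩
      · exact .inr h₁
    · rintro (⟨h₁, h₂⟩ | rfl)
      · exact ⟨.inl h₁, h₂⟩
      -- The bound `B` also covers the timestamps in `matched`, so the new push cannot be matched
      -- already.
      · refine ⟨.inr rfl, ?_, fun ts' h => (hB.2 _ h).1.not_gt heB⟩
        rw [he]; trivial
  have hold : ∀ b ∈ insert null S.pushedAddr, fupd f n e b = f b := by
    rintro b (rfl | hb)
    · exact fupd_ne _ _ hn.symm
    · exact fupd_ne _ _ (hnp b hb)
  have hlt : ∀ b ∈ insert null S.pushedAddr, tst (f b) < tst e := by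
    rintro b (rfl | hb)
    · exact hen
    · exact (hB.1 _ (F.node b hb).1.1).trans_lt heB
  have hnextmem : ∀ a ∈ S.pushedAddr, LibState.next S.lib a ∈ insert null S.pushedAddr := by
    intro a ha
    by_cases h : LibState.next S.lib a = null
    · exact .inl h
    · exact .inr (M.next_pushed ha h)
  have htopmem : S.lib.lastVal .Top ∈ insert null S.pushedAddr := by
    by_cases h : S.lib.lastVal .Top = null
    · exact .inl h
    · exact .inr (M.top_pushed h)
  have hnext' : ∀ a, LibState.next S'.lib a = LibState.next S.lib a :=
    fun a => (C.cell _).lastVal_eq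
  have hsame : fupd f n e n = e := fupd_same _ _ _
  refine ⟨?_, ?_, ?_, ?_, ?_, ?_⟩
  · have hmem : ∀ b ∈ insert null S'.pushedAddr, b = n ∨ b ∈ insert null S.pushedAddr := by
      rw [hpushed]
      rintro b (hb | hb | hb)
      · exact .inr (.inl hb)
      · exact .inr (.inr hb)
      · exact .inl hb
    intro a ha b hb hab
    rcases hmem a ha with rfl | ha <;> rcases hmem b hb with rfl | hb
    · rfl
    · rw [hsame, hold b hb] at hab
      exact ((hlt b hb).ne (congrArg tst hab.symm)).elim
    · rw [hsame, hold a ha] at hab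
      exact ((hlt a ha).ne (congrArg tst hab)).elim
    · rw [hold a ha, hold b hb] at hab
      exact F.inj ha hb hab
  · rw [hold null (.inl rfl)]; exact F.null_eq
  · rw [hpushed]
    rintro a (ha | rfl)
    · rw [hnext', hold a (.inr ha), hold _ (hnextmem a ha), (C.cell a).lastVal_eq]
      exact ⟨(hU _).2 (.inl (F.node a ha).1), (F.node a ha).2⟩
    · rw [hnext', hnext, hsame, hold _ htopmem, (C.cell a).lastVal_eq]
      exact ⟨(hU _).2 (.inr rfl), by rw [he]; rfl, hlt _ htopmem⟩
  · rw [hpushed]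
    rintro a (ha | rfl) op hop
    · rw [hnext', hold a (.inr ha), hold _ (hnextmem a ha)]
      rcases (hU op).1 hop with hop | rfl
      · exact F.gap a ha op hop
      · exact fun _ _ => .inr (hlt a (.inr ha))
    · rw [hnext', hnext, hsame, hold _ htopmem]
      intro h₁ h₂
      have hop := ((hU op).1 hop).resolve_right h₁
      left
      by_cases h : S.lib.lastVal .Top = null
      · rw [h]; exact htop h op hop
      · exact ((F.top h).2 op hop).lt_of_ne fun h' =>
          h₂ (F.eq_of_tst (M.top_pushed h) hop h')
  · intro _
    rw [C.new_top, hsame]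
    refine ⟨(hU _).2 (.inr rfl), fun op hop => ?_⟩
    rcases (hU op).1 hop with hop | rfl
    · exact (hB.1 _ hop.1).trans heB.le
    · exact le_rfl
  · rw [hpushed, hmview]
    rintro a (ha | rfl) w hw hx hwv
    · rw [hold a (.inr ha), fupd_ne _ _ fun h => (hlt a (.inr ha)).ne (congrArg tst h)]
      by_cases hm : w ∈ S.lib.ops
      · rw [C.mviewCtx w hm]
        exact F.seen a ha w hm hx hwv
      · exact (hnp a ha (Option.some.inj (hwv.symm.trans (C.new w hw hm).1))).elim
    · rw [hsame, fupd_same]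
      -- Since `n` was never written to `Top` before, the only such write is the CAS itself, which
      -- records the client view of `t`.
      by_cases hm : w ∈ S.lib.ops
      · exact (hnew w ⟨hm, hx, hwv, hn⟩).elim
      · rw [(C.new w hw hm).2]; exact hv

/-- The map `f` is unchanged. Once `f a` is matched, every other unmatched push lies at or before
the image of the next node, because none lies between the two. -/
theorem pop (F : StackMap α S f) (M : S.MemOK) {a : ℕ} (C : S.Cas t (LibState.next S.lib a) S')
    {e : StackAct × ℚ} (hn : a ≠ null) (htop : S.lib.lastVal .Top = a)
    (hpushed : S'.pushedAddr = S.pushedAddr \ {a})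
    (hsaw : LibState.Saw S.lib (S.lib.tview t) (S.cl.tview t) a) (he : ¬ e.1.IsPush)
    (hops : α'.ops = α.ops ∪ {e}) (hmatched : α'.matched = α.matched ∪ {(tst (f a), tst e)})
    (hmview : α'.mviewCtx = α.mviewCtx) : StackMap α' S' f := by
  have ha : a ∈ S.pushedAddr := htop ▸ M.top_pushed (htop.trans_ne hn)
  have hU : ∀ op, op ∈ α'.unmatchedPush ↔ op ∈ α.unmatchedPush ∧ op ≠ f a := by
    intro op
    unfold StackState.unmatchedPush
    rw [hops, hmatched]
    constructor
    · rintro ⟨h₁ | rfl, h₂, h₃⟩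
      · refine ⟨⟨h₁, h₂, fun ts' h => h₃ ts' (.inl h)⟩, ?_⟩
        rintro rfl
        exact h₃ (tst e) (.inr rfl)
      · exact (he h₂).elim
    · rintro ⟨h, hne⟩
      refine ⟨.inl h.1, h.2.1, ?_⟩
      rintro ts' (h' | h')
      · exact h.2.2 ts' h'
      -- `matched` relates timestamps only, so one needs that no other unmatched push shares the
      -- timestamp of `f a`.
      · exact hne (F.eq_of_tst ha h (Prod.ext_iff.1 h').1)
  have hnext' : ∀ a, LibState.next S'.lib a = LibState.next S.lib a :=
    fun a => (C.cell _).lastVal_eq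
  have hmem : ∀ b ∈ S'.pushedAddr, b ∈ S.pushedAddr ∧ b ≠ a := by
    rw [hpushed]; exact fun b hb => hb
  have htop' := F.top (htop.trans_ne hn)
  rw [htop] at htop'
  refine ⟨F.inj.mono ?_, F.null_eq, ?_, ?_, ?_, ?_⟩
  · rw [hpushed]; exact Set.insert_subset_insert Set.sdiff_subset
  · intro b hb
    obtain ⟨hb, hba⟩ := hmem b hb
    rw [hnext', (C.cell b).lastVal_eq]
    refine ⟨(hU _).2 ⟨(F.node b hb).1, fun h => hba ?_⟩, (F.node b hb).2⟩
    exact F.inj (.inr hb) (.inr ha) h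
  · intro b hb op hop
    rw [hnext']
    exact F.gap b (hmem b hb).1 op ((hU op).1 hop).1
  · rw [C.new_top]
    intro hnn
    have hnp := M.next_pushed ha hnn
    refine ⟨(hU _).2 ⟨(F.node _ hnp).1, fun h => (F.node a ha).2.2.ne (congrArg tst h)⟩, ?_⟩
    intro op hop
    obtain ⟨hop, hne⟩ := (hU op).1 hop
    by_cases h : op = f (LibState.next S.lib a)
    · rw [h]
    · rcases F.gap a ha op hop hne h with h' | h'
      · exact h'.le
      · exact ((htop'.2 op hop).not_gt h').elim
  · rw [hmview]
    intro b hb w hw hx hwv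
    obtain ⟨hb, hba⟩ := hmem b hb
    by_cases hm : w ∈ S.lib.ops
    · rw [C.mviewCtx w hm]
      exact F.seen b hb w hm hx hwv
    · obtain ⟨h₁, h₂⟩ := C.new w hw hm
      obtain rfl : b = LibState.next S.lib a := Option.some.inj (hwv.symm.trans h₁)
      rw [h₂]
      -- The new write records the client view of `t`, and `t` has seen an earlier write of the next
      -- node by way of `a`.
      exact F.seen_saw hb ((M.knows hsaw).2.2.2 (M.ne_null hb))

end StackMap

/-! ### Matching the library steps by abstract steps -/

theorem RTS.stackMap {A : AState T R X} (h : RTS A S) : ∃ f, StackMap A.lib S f := by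
  obtain ⟨-, -, -, -, f, h₁, h₂, h₃, h₄, h₅, -, h₆, -⟩ := h
  exact ⟨f, h₁, h₂, h₃, h₄, h₅, h₆⟩

theorem RTS.tview_le {A : AState T R X} (h : RTS A S) (t : T) :
    (A.cl.tview t).Le (S.cl.tview t) := by
  obtain ⟨-, -, -, -, f, -, -, -, -, -, -, -, h⟩ := h
  exact h t

/-- The return values are taken from `S'`, so that the lemma applies both to stuttering and to the
return of a pop. -/
theorem RTS.quiet {A : AState T R X} (h : RTS A S) (M : S.MemOK) (Q : S.Quiet t S')
    (M' : S'.MemOK) : RTS { A with rval := S'.rval } S' := by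
  obtain ⟨f, F⟩ := h.stackMap
  exact (F.quiet M Q).rts (A := { A with rval := S'.rval }) M' (h.1.trans Q.regs.symm) rfl
    (h.2.2.1.trans Q.cl_ops.symm) (h.2.2.2.1.trans Q.cl_cvd.symm)
    fun t' => (h.tview_le t').trans (Q.cl_le t')

theorem le_of_setView {L A L' A' : Type*} {γ : CompState T L A L' A'} {g g' : T → View L A}
    {V : View L A} (h : ∀ t', (γ.tview t').Le (g t')) (hg : ∀ t', (g t').Le (g' t'))
    (hV : V.Le (g t)) (t' : T) : ((γ.setView t V).tview t').Le (g' t') := by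
  change (fupd γ.tview t V t').Le (g' t')
  by_cases ht : t' = t
  · subst ht
    rw [fupd_same]
    exact hV.trans (hg t')
  · rw [fupd_ne _ _ ht]
    exact (h t').trans (hg t')

/-- A successful push is matched by an abstract push. -/
theorem RTS.exists_push {A : AState T R X} (h : RTS A S) (M : S.MemOK) (M' : S'.MemOK)
    {e : Regs R → ℕ} (hok : S.RunOK t (.pushCas e)) (C : S.Cas t (S.reg t).nVal S')
    (hpushed : S'.pushedAddr = S.pushedAddr ∪ {(S.reg t).nVal})
    (hrval : S'.rval = fupd S.rval t none) (hB : ∃ B, A.lib.BoundedBy B) :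
    ∃ α' v', StackStep t (.push true (e (A.regs t))) A.lib (A.cl.tview t) α' v' ∧
      RTS { A with rval := fupd A.rval t none, cl := A.cl.setView t v', lib := α' } S' := by
  obtain ⟨B, hB⟩ := hB
  obtain ⟨f, F⟩ := h.stackMap
  obtain ⟨f, F, hnull⟩ := F.exists_null_late M hB
  obtain ⟨⟨o₁, -, -, -, -, o₆⟩, ok₂, ok₃⟩ := hok
  -- `f null` is not required to be an operation of the abstract stack, so `B` need not bound it and
  -- it enters separately.
  obtain ⟨q, hq⟩ := exists_gt (max (max B (tst (A.lib.tview t ()))) (tst (f null)))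
  obtain ⟨⟨hqB, hqt⟩, hqn⟩ : (B < q ∧ tst (A.lib.tview t ()) < q) ∧ tst (f null) < q := by
    simpa only [max_lt_iff] using hq
  refine ⟨_, _, .pushSync (e (A.regs t)) q A.lib _ (A.cl.tview t)
    ⟨hqt, fun p hp => .inr ((hB.2 p hp).2.trans_lt hqB), rfl⟩, ?_⟩
  refine StackMap.rts (F.push (e := (.push true (e (A.regs t)), q)) (v := A.cl.tview t) M C o₁
    (fun w hw => (o₆ w _ hw).1 rfl) (ok₃.trans C.old_top.symm) hpushed hB hnull
    (by rw [ok₂, h.1]) hqB hqn (h.tview_le t) rfl rfl rfl) M' (h.1.trans C.regs.symm) ?_ (h.2.2.1.trans C.cl_ops.symm)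
    (h.2.2.2.1.trans C.cl_cvd.symm) (le_of_setView h.tview_le C.cl_le (h.tview_le t))
  rw [hrval]
  exact congrArg (fupd · t none) h.2.1

/-- A successful pop is matched by an abstract pop. -/
theorem RTS.exists_pop {A : AState T R X} (h : RTS A S) (M : S.MemOK) (M' : S'.MemOK)
    (hok : S.RunOK t (.popCas : CRun R)) (C : S.Cas t (S.reg t).nTop S')
    (hpushed : S'.pushedAddr = S.pushedAddr \ {(S.reg t).top})
    (hrval : S'.rval = S.rval) (hB : ∃ B, A.lib.BoundedBy B) :
    ∃ α' v', StackStep t (.pop true (.num (S.lib.lastVal (.cell (S.reg t).top)))) A.lib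
        (A.cl.tview t) α' v' ∧
      RTS { A with rval := fupd A.rval t (A.rval t), cl := A.cl.setView t v', lib := α' } S' := by
  obtain ⟨B, hB⟩ := hB
  obtain ⟨f, F⟩ := h.stackMap
  obtain ⟨hn, hnext⟩ := hok
  rw [hnext] at C
  have htop := C.old_top
  have hsaw := M.reg_top t hn
  generalize (S.reg t).top = a at hn hnext C hpushed htop hsaw
  have ha : a ∈ S.pushedAddr := htop ▸ M.top_pushed (htop.trans_ne hn)
  obtain ⟨⟨hfo, hfp, hfm⟩, hfv, -⟩ := F.node a ha
  have hmax := (F.top (htop.trans_ne hn)).2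
  rw [htop] at hmax
  obtain ⟨rel, ts, hf⟩ : ∃ rel ts, f a = (.push rel (S.lib.lastVal (.cell a)), ts) := by
    rcases hfa : f a with ⟨rel | _, ts⟩
    · rw [hfa] at hfv
      exact ⟨rel, ts, by rw [Option.some.inj hfv]⟩
    · rw [hfa] at hfp
      exact hfp.elim
  obtain ⟨q, hq⟩ := exists_gt (max B (tst (A.lib.tview t ())))
  obtain ⟨hqB, hqt⟩ : B < q ∧ tst (A.lib.tview t ()) < q := by
    simpa only [max_lt_iff] using hq
  obtain ⟨α', base, h₁, h₂, h₃⟩ : ∃ α', PopBase t (.pop true (.num (S.lib.lastVal (.cell a))), q)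
      (.push rel (S.lib.lastVal (.cell a)), ts) A.lib α' ∧
      α'.ops = A.lib.ops ∪ {(.pop true (.num (S.lib.lastVal (.cell a))), q)} ∧
      α'.matched = A.lib.matched ∪ {(tst (f a), q)} ∧ α'.mviewCtx = A.lib.mviewCtx := by
    rw [← hf]
    refine ⟨_, ⟨_, ⟨hqt, fun p hp => .inr ((hB.2 p hp).2.trans_lt hqB), rfl⟩, hfo, hfm,
      (hB.1 _ hfo).trans_lt hqB, fun o ho hp hlt _ => ?_, rfl⟩, rfl, rfl, rfl⟩
    -- An unmatched push after `f a` would contradict that the top node is mapped to the last one.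
    by_contra hex
    exact (hmax o ⟨ho, hp, fun ts' hts => hex ⟨ts', hts⟩⟩).not_gt hlt
  have rts : ∀ (α' : StackState T X) (v' : View X (Act X Val)),
      α'.ops = A.lib.ops ∪ {(.pop true (.num (S.lib.lastVal (.cell a))), q)} →
      α'.matched = A.lib.matched ∪ {(tst (f a), q)} → α'.mviewCtx = A.lib.mviewCtx →
      v'.Le (S.cl.tview t) →
      RTS { A with rval := fupd A.rval t (A.rval t), cl := A.cl.setView t v', lib := α' } S' := by
    intro α' v' h₁ h₂ h₃ hv
    refine (F.pop (α' := α') M C hn htop hpushed hsaw (e := (.pop true (.num _), q)) id h₁ h₂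
      h₃).rts M' (h.1.trans C.regs.symm) ?_ (h.2.2.1.trans C.cl_ops.symm)
      (h.2.2.2.1.trans C.cl_cvd.symm) (le_of_setView h.tview_le C.cl_le hv)
    rw [hrval]
    exact (fupd_self _ _).trans h.2.1
  -- `RTS` does not say that the push `f a` is releasing, so the pop may or may not synchronise with
  -- it.
  cases rel with
  | false =>
    exact ⟨_, _, .popRlx true false _ ts q A.lib _ _ base nofun,
      rts _ _ h₁ h₂ h₃ (h.tview_le t)⟩
  | true =>
    refine ⟨_, _, .popSync _ ts q A.lib _ _ base, rts _ _ h₁ h₂ h₃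
      (View.join_le (h.tview_le t) ?_)⟩
    -- The client view joined in is that of the push, already contained in the concrete view since
    -- `t` saw a write of the node to `Top`.
    rw [← hf]
    exact F.seen_saw ha hsaw

/-- The simulation of a library step. -/
theorem RTS.simulates (I : Ψ.OK) (hs : CLibStep Ψ Ψ') (hB : ∃ B, Ω.st.lib.BoundedBy B)
    (hc : Corr Ω Ψ) (h : RTS Ω.st Ψ.st) :
    (Corr Ω Ψ' ∧ RTS Ω.st Ψ'.st) ∨ ∃ Ω', AStep Ω Ω' ∧ Corr Ω' Ψ' ∧ RTS Ω'.st Ψ'.st := by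
  obtain ⟨I', ev⟩ := I.libStep hs
  have M := I.mem
  have M' := I'.mem
  cases ev with
  | quiet t d d' c' hs hprog Q hrval hrun =>
    obtain ⟨d₀, hd, hh⟩ := hc.holeStep I hs hprog Q.toEvolves
    obtain ⟨a', hs', hc'⟩ := hh _ (.run _ _ (hrun d₀ hd))
    left
    rw [hs'.eq_of_run, fupd_self] at hc'
    refine ⟨hc' Ω.st, ?_⟩
    have := h.quiet M Q M'
    rwa [hrval, ← h.2.1] at this
  | ret t c' v hs hprog Q hrval hv =>
    obtain ⟨d₀, hd, hh⟩ := hc.holeStep I hs hprog Q.toEvolves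
    obtain ⟨a', hs', hc'⟩ := hh _ (.val _)
    cases hd
    -- The abstract result is the last value in the popped node, which is what the concrete read
    -- returned.
    rw [hv] at hs'
    refine .inr ⟨_, .libEps Ω t _ _ a' _ hs' (.ret _ _), hc' _, ?_⟩
    have := h.quiet M Q M'
    rwa [hrval, ← h.2.1] at this
  | push t e c' hs hprog C hrval hpushed =>
    obtain ⟨d₀, hd, hh⟩ := hc.holeStep I hs hprog C.toEvolves
    obtain ⟨a', hs', hc'⟩ := hh _ (.val _)
    cases hd
    obtain ⟨α', v', hst, hr⟩ := h.exists_push M M' (I.runOK hs) C hpushed hrval hB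
    exact .inr ⟨_, .libAct Ω t _ _ a' _ _ α' v' hs' (.push e _) hst, hc' _, hr⟩
  | pop t c' hs hprog C hrval hpushed =>
    obtain ⟨d₀, hd, hh⟩ := hc.holeStep I hs hprog C.toEvolves
    obtain ⟨a', hs', hc'⟩ := hh _ (.run _ _ .popRet)
    cases hd
    -- The correspondence after the CAS speaks of the new state, but the CAS alters neither cells
    -- nor registers, so the abstract pop returns the value stored before it.
    rw [(C.cell _).lastVal_eq, C.reg_eq] at hs'
    obtain ⟨α', v', hst, hr⟩ := h.exists_pop M M' (I.runOK hs) C hpushed hrval hB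
    exact .inr ⟨_, .libAct Ω t _ _ a' _ _ α' v' hs' (.pop _ _) hst, hc' _, hr⟩

theorem RTS.init (C : Client T R X) (k : X → Val) (l : T → Regs R) :
    RTS (AConf.init C k l).st (CConf.init C k l).st := by
  have M := (CConf.OK.init C k l).mem
  have htop : (CConf.init C k l).st.lib.lastVal .Top = null := by
    by_contra h
    exact M.top_pushed h
  refine StackMap.rts (f := fun _ => (.pop false .empty, 0)) ⟨?_, ⟨_, _, rfl⟩, ?_, ?_, ?_, ?_⟩ M
    rfl rfl rfl rfl fun t => View.Le.refl _
  · rintro a (rfl | ha) b (rfl | hb) -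
    · rfl
    · exact hb.elim
    · exact ha.elim
    · exact ha.elim
  · exact fun a ha => ha.elim
  · exact fun a ha => ha.elim
  · exact fun h => (h htop).elim
  · exact fun a ha => ha.elim

theorem RTS.obs {A : AState T R X} (h : RTS A S) (t : T) (x : X) :
    S.cl.Obs t x ⊆ A.cl.Obs t x := by
  rintro w ⟨h₁, h₂, h₃⟩
  exact ⟨h.2.2.1 ▸ h₁, h₂, (h.tview_le t x).trans h₃⟩

end Simulation

end TreiberC11

end

theorem mainTheorem2 {T R X : Type*} (C : TreiberC11.Client T R X)
    (hC : ∀ t, (C t).SyncFree) (k : X → TreiberC11.Val) (l : T → TreiberC11.Regs R) :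
    TreiberC11.IsForwardSimulation C k l TreiberC11.RTS := by
  refine ⟨fun A S h => ⟨h.1, fun t => ⟨h.obs t, congrFun h.2.1 t⟩⟩, ⟨fun t => ?_, ?_⟩, ?_⟩
  · refine TreiberC11.ComCorr.map (fun m => ?_) (C t)
    cases m with
    | push e => exact .pushNew e
    | pop => exact .popTop
  · exact TreiberC11.RTS.init C k l
  · intro Ω Ψ Ψ' hΩ hΨ hc h hs
    exact TreiberC11.RTS.simulates (.of_reachable hΨ) hs
      (TreiberC11.AStep.bounded_of_reachable hΩ) hc h
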